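/- Let $d\ge 1$ and let $D\subset\mathbb R^d$ be a bounded connected nonempty open set with Lipschitz boundary. Let $\sigma:\mathbb R^d\to\mathbb R$ (the surface tension) be a $C^1$ function for which there are constants $c_-,c_+>0$ with $$c_-|u-v|^2\le(\nabla\sigma(u)-\nabla\sigma(v))\cdot(u-v)\le c_+|u-v|^2,\qquad u,v\in\mathbb R^d .$$ Let $\rho\in C_0^\infty(\mathbb R^d)$ be nonnegative with $\rho(-u)=\rho(u)$, $\operatorname{supp}\rho\subset\{|u|<1\}$ and $\int\rho=1$, and for $0<\delta\le1$ put $\rho_\delta(u)=\delta^{-d}\rho(\delta^{-1}u)$ and $\sigma^\delta=\sigma*\rho_\delta$. Let $H^1(D)^*$ be the dual of $H^1(D)$, into which $L^2(D)$ is embedded through the $L^2$ inner product, and let $H=\{\xi\in H^1(D)^*:\langle\xi,1\rangle=0\}$ with inner product $(\xi,\eta)_H=(\nabla G\xi,\nabla G\eta)_{L^2(D)}$, where $g=G\xi\in H^1(D)$ is the solution of $(\nabla g,\nabla J)_{L^2(D)}=\langle\xi,J\rangle$ for all $J\in H^1(D)$, $(g,1)_{L^2(D)}=0$. Let $V=\{w\in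 H^1_0(D):\int_D w=0\}$, and regard $V\subset H\subset V^*$, where $\xi\in H$ acts on $g\in V$ by $(\xi,g)_H$. For $f\in H_0^1(D)$ and $w\in V$ let $A_f(w)=-\Delta\operatorname{div}(\nabla\sigma(\nabla w+\nabla f))\in V^*$, that is, ${}_{V^*}\langle A_f(w),g\rangle_V=-(\nabla\sigma(\nabla w+\nabla f),\nabla g)_{L^2(D)}$ for $g\in V$. Let $T>0$. A function $h:[0,T]\to H^1(D)^*$ is a solution of $$\partial_t h=-\Delta\operatorname{div}\{(\nabla\sigma)(\nabla h)\}\ \text{ in } D,\qquad h=0\ \text{ in } D^c,$$ with initial datum $h_0\in H^1(D)^*$ if there is $f\in H_0^1(D)$ with $\langle h_0,1\rangle=\langle f,1\rangle$ such that $h_f:=h-f$ is absolutely continuous from $[0,T]$ to $V^*$, $h_f\in C([0,T];H)\cap L^2(0,T;V)\cap W^{1,2}([0,T];V^*)$, $h_f(0)=h_0-f$, and $\frac{d}{dt}h_f(t)=A_f(h_f(t))$ in $V^*$ for almost every $t\in[0,T]$. Solutions of the equation with $\sigma^\delta$ in place of $\sigma$ are defined in the same way. Let $h$ be a solution of the equation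 with $\sigma$ and, for $0<\delta\le1$, let $h^\delta$ be a solution of the equation with $\sigma^\delta$, all on $[0,T]$ and with the same initial datum $h_0\in H^1(D)^*$. Then, for every $t\in[0,T]$, $$\lim_{\delta\to0+}\|h(t)-h^\delta(t)\|_{H^1(D)^*}=0 .$$ -/

import Mathlib

open MeasureTheory Set Filter Topology
open scoped ContDiff NNReal Convolution

noncomputable section

namespace InterfacePDE

/-- The Euclidean space `ℝ^d`. -/
abbrev Space (d : ℕ) := EuclideanSpace ℝ (Fin d)

/-- `D` has a Lipschitz boundary: near every boundary point `p` there is a direction `n` in which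
`D` is the region strictly above the graph of a Lipschitz function defined on the
hyperplane orthogonal to `n`. -/
def HasLipschitzBoundary {d : ℕ} (D : Set (Space d)) : Prop :=
  ∀ p ∈ frontier D, ∃ n : Space d, ‖n‖ = 1 ∧ ∃ r : ℝ, 0 < r ∧
    ∃ (K : ℝ≥0) (γ : ((Submodule.span ℝ {n})ᗮ : Submodule ℝ (Space d)) → ℝ), LipschitzWith K γ ∧
      ∀ x ∈ Metric.ball p r,
        x ∈ D ↔ γ ((Submodule.span ℝ {n})ᗮ.orthogonalProjectionOnto x) < inner ℝ n x

/-- A bounded connected (nonempty) open subset of `ℝ^d` with a Lipschitz boundary. -/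
structure LipschitzDomain (d : ℕ) where
  carrier : Set (Space d)
  isOpen : IsOpen carrier
  isBounded : Bornology.IsBounded carrier
  isConnected : IsConnected carrier
  hasLipschitzBoundary : HasLipschitzBoundary carrier

variable {d : ℕ}

/-- Lebesgue measure on `D`. -/
abbrev LipschitzDomain.vol (D : LipschitzDomain d) : Measure (Space d) :=
  volume.restrict D.carrier

instance LipschitzDomain.isFiniteMeasure_vol (D : LipschitzDomain d) : IsFiniteMeasure D.vol :=
  ⟨by simpa using D.isBounded.measure_lt_top⟩

/-- `φ ∈ C_c^∞(D)`. -/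
structure IsTest (D : LipschitzDomain d) (φ : Space d → ℝ) : Prop where
  contDiff : ContDiff ℝ ∞ φ
  hasCompactSupport : HasCompactSupport φ
  tsupport_subset : tsupport φ ⊆ D.carrier

/-! ### The Sobolev spaces `H¹(D)`, `H₀¹(D)` -/

/-- `p` is the weak gradient of `u` on `D`. -/
def IsWeakGradient (D : LipschitzDomain d) (u : Space d → ℝ) (p : Space d → Space d) : Prop :=
  ∀ φ : Space d → ℝ, IsTest D φ → ∀ i : Fin d,
    ∫ x in D.carrier, u x * fderiv ℝ φ x (EuclideanSpace.single i 1) =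
      -∫ x in D.carrier, p x i * φ x

/-- `L²(D)`. -/
abbrev L2 (D : LipschitzDomain d) := Lp ℝ 2 D.vol

/-- `L²(D; ℝ^d)`. -/
abbrev L2Vec (D : LipschitzDomain d) := Lp (Space d) 2 D.vol

theorem IsTest.memLp_deriv {D : LipschitzDomain d} {φ : Space d → ℝ} (hφ : IsTest D φ)
    (i : Fin d) : MemLp (fun x => fderiv ℝ φ x (EuclideanSpace.single i 1)) 2 D.vol := by
  have hc : Continuous fun x => fderiv ℝ φ x (EuclideanSpace.single i 1) :=
    (hφ.contDiff.continuous_fderiv (by simp)).clm_apply continuous_const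
  have hs : HasCompactSupport fun x => fderiv ℝ φ x (EuclideanSpace.single i 1) :=
    hφ.hasCompactSupport.fderiv_apply ℝ _
  exact (hc.memLp_of_hasCompactSupport hs).restrict _

theorem IsTest.memLp {D : LipschitzDomain d} {φ : Space d → ℝ} (hφ : IsTest D φ) :
    MemLp φ 2 D.vol :=
  (hφ.contDiff.continuous.memLp_of_hasCompactSupport hφ.hasCompactSupport).restrict _

theorem memLp_coord {D : LipschitzDomain d} (p : L2Vec D) (i : Fin d) :
    MemLp (fun x => p x i) 2 D.vol :=
  (Lp.memLp p).continuousLinearMap_comp (EuclideanSpace.proj i : Space d →L[ℝ] ℝ)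

theorem IsWeakGradient.add {D : LipschitzDomain d} {u u' : L2 D} {p p' : L2Vec D}
    (h : IsWeakGradient D u p) (h' : IsWeakGradient D u' p') :
    IsWeakGradient D (u + u' : L2 D) (p + p' : L2Vec D) := by
  intro φ hφ i
  have e1 : ∫ x in D.carrier, (u + u' : L2 D) x * fderiv ℝ φ x (EuclideanSpace.single i 1) =
      ∫ x in D.carrier, (u x * fderiv ℝ φ x (EuclideanSpace.single i 1) +
        u' x * fderiv ℝ φ x (EuclideanSpace.single i 1)) := by
    refine integral_congr_ae ?_
    filter_upwards [Lp.coeFn_add u u'] with x hx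
    rw [hx, Pi.add_apply, add_mul]
  have e2 : ∫ x in D.carrier, (p + p' : L2Vec D) x i * φ x =
      ∫ x in D.carrier, (p x i * φ x + p' x i * φ x) := by
    refine integral_congr_ae ?_
    filter_upwards [Lp.coeFn_add p p'] with x hx
    rw [hx, Pi.add_apply, PiLp.add_apply, add_mul]
  have i1 := (Lp.memLp u).integrable_mul (hφ.memLp_deriv i)
  have i2 := (Lp.memLp u').integrable_mul (hφ.memLp_deriv i)
  have i3 := (memLp_coord p i).integrable_mul hφ.memLp
  have i4 := (memLp_coord p' i).integrable_mul hφ.memLp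
  rw [e1, e2]
  refine (integral_add i1 i2).trans ?_
  refine Eq.trans ?_ (congrArg Neg.neg (integral_add i3 i4)).symm
  have h1 := h φ hφ i
  have h2 := h' φ hφ i
  simp only [Pi.mul_apply]
  rw [h1, h2]
  ring

theorem IsWeakGradient.smul {D : LipschitzDomain d} {u : L2 D} {p : L2Vec D} (c : ℝ)
    (h : IsWeakGradient D u p) : IsWeakGradient D (c • u : L2 D) (c • p : L2Vec D) := by
  intro φ hφ i
  have e1 : ∫ x in D.carrier, (c • u : L2 D) x * fderiv ℝ φ x (EuclideanSpace.single i 1) =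
      ∫ x in D.carrier, c * (u x * fderiv ℝ φ x (EuclideanSpace.single i 1)) := by
    refine integral_congr_ae ?_
    filter_upwards [Lp.coeFn_smul c u] with x hx
    rw [hx, Pi.smul_apply, smul_eq_mul, mul_assoc]
  have e2 : ∫ x in D.carrier, (c • p : L2Vec D) x i * φ x =
      ∫ x in D.carrier, c * (p x i * φ x) := by
    refine integral_congr_ae ?_
    filter_upwards [Lp.coeFn_smul c p] with x hx
    rw [hx, Pi.smul_apply, PiLp.smul_apply, smul_eq_mul, mul_assoc]
  rw [e1, e2, integral_const_mul, integral_const_mul, h φ hφ i, mul_neg]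

theorem isWeakGradient_zero (D : LipschitzDomain d) :
    IsWeakGradient D (0 : L2 D) (0 : L2Vec D) := by
  have key : ∀ (u : L2 D) (p : L2Vec D), u =ᵐ[D.vol] 0 → p =ᵐ[D.vol] 0 →
      IsWeakGradient D u p := by
    intro u p hu hp φ _ i
    rw [integral_eq_zero_of_ae, integral_eq_zero_of_ae, neg_zero]
    · filter_upwards [hp] with x hx
      simp [hx]
    · filter_upwards [hu] with x hx
      simp [hx]
  exact key _ _ (Lp.coeFn_zero ℝ 2 D.vol) (Lp.coeFn_zero (Space d) 2 D.vol)

/-- The space of pairs `(u, ∇u)` in `L²(D) × L²(D; ℝ^d)`, where `∇u` is the weak gradient of `u`. -/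
def H1Submodule (D : LipschitzDomain d) : Submodule ℝ (WithLp 2 (L2 D × L2Vec D)) where
  carrier := {w | IsWeakGradient D w.fst w.snd}
  add_mem' h h' := IsWeakGradient.add h h'
  zero_mem' := isWeakGradient_zero D
  smul_mem' c _ h := IsWeakGradient.smul c h

/-- `H¹(D)`, realised as the space of pairs `(u, ∇u)`, with the inner product
`(u, w)_{L²} + (∇u, ∇w)_{L²}`. -/
def H1 (D : LipschitzDomain d) : Type := H1Submodule D

instance (D : LipschitzDomain d) : NormedAddCommGroup (H1 D) :=
  inferInstanceAs (NormedAddCommGroup (H1Submodule D))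

instance (D : LipschitzDomain d) : InnerProductSpace ℝ (H1 D) :=
  inferInstanceAs (InnerProductSpace ℝ (H1Submodule D))

/-- The inclusion `H¹(D) → L²(D)`. -/
def toL2 (D : LipschitzDomain d) : H1 D →L[ℝ] L2 D :=
  (WithLp.fstL 2 ℝ (L2 D) (L2Vec D)).comp (H1Submodule D).subtypeL

/-- The weak gradient `H¹(D) → L²(D; ℝ^d)`. -/
def grad (D : LipschitzDomain d) : H1 D →L[ℝ] L2Vec D :=
  (WithLp.sndL 2 ℝ (L2 D) (L2Vec D)).comp (H1Submodule D).subtypeL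

theorem isWeakGradient_one (D : LipschitzDomain d) :
    IsWeakGradient D (Lp.const 2 D.vol (1 : ℝ)) (0 : L2Vec D) := by
  intro φ hφ i
  have hd : Differentiable ℝ φ := hφ.contDiff.differentiable (by simp)
  have hc : Continuous fun x => fderiv ℝ φ x (EuclideanSpace.single i 1) :=
    (hφ.contDiff.continuous_fderiv (by simp)).clm_apply continuous_const
  have hs : HasCompactSupport fun x => fderiv ℝ φ x (EuclideanSpace.single i 1) :=
    hφ.hasCompactSupport.fderiv_apply ℝ _
  have j1 := hc.integrable_of_hasCompactSupport (μ := (volume : Measure (Space d))) hs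
  have j2 := hφ.contDiff.continuous.integrable_of_hasCompactSupport
    (μ := (volume : Measure (Space d))) hφ.hasCompactSupport
  have e0 : ∫ x, fderiv ℝ φ x (EuclideanSpace.single i 1) = 0 := by
    have := integral_mul_fderiv_eq_neg_fderiv_mul_of_integrable
      (μ := (volume : Measure (Space d))) (f := fun _ : Space d => (1 : ℝ)) (g := φ)
      (v := EuclideanSpace.single i 1) (by simp) (by simpa using j1) (by simpa using j2)
      (fun x _ => differentiableAt_const _) (fun x _ => hd x)
    simpa using this
  have e1 : ∫ x in D.carrier, (Lp.const 2 D.vol (1 : ℝ)) x *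
      fderiv ℝ φ x (EuclideanSpace.single i 1) =
      ∫ x in D.carrier, fderiv ℝ φ x (EuclideanSpace.single i 1) := by
    refine integral_congr_ae ?_
    filter_upwards [Lp.coeFn_const (p := 2) (μ := D.vol) (1 : ℝ)] with x hx
    rw [hx, Function.const_apply, one_mul]
  have e2 : ∫ x in D.carrier, (0 : L2Vec D) x i * φ x = 0 := by
    refine integral_eq_zero_of_ae ?_
    filter_upwards [Lp.coeFn_zero (Space d) 2 D.vol] with x hx
    rw [hx]
    simp
  rw [e1, e2, neg_zero, setIntegral_eq_integral_of_forall_compl_eq_zero, e0]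
  intro x hx
  have : fderiv ℝ φ x = 0 := by
    by_contra hne
    exact hx (hφ.tsupport_subset (support_fderiv_subset ℝ hne))
  simp [this]

/-- The constant function `1`, as an element of `H¹(D)`. -/
def one (D : LipschitzDomain d) : H1 D :=
  ⟨WithLp.toLp 2 (Lp.const 2 D.vol (1 : ℝ), 0), isWeakGradient_one D⟩

theorem grad_one (D : LipschitzDomain d) : grad D (one D) = 0 := rfl

/-- `H₀¹(D)`, the closure of `C_c^∞(D)` in `H¹(D)`. -/
def H10 (D : LipschitzDomain d) : Submodule ℝ (H1 D) :=
  (Submodule.span ℝ {w : H1 D | ∃ φ, IsTest D φ ∧ toL2 D w =ᵐ[D.vol] φ}).topologicalClosure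

/-- The functional `w ↦ (1, w)_{L²(D)} = ∫_D w` on `H¹(D)`. -/
def integralL (D : LipschitzDomain d) : H1 D →L[ℝ] ℝ :=
  (innerSL ℝ (toL2 D (one D))).comp (toL2 D)

/-- `{w ∈ H¹(D) ; (w, 1) = 0}`. -/
def H1MeanZero (D : LipschitzDomain d) : Submodule ℝ (H1 D) := (integralL D).ker

/-- `V = {w ∈ H₀¹(D) ; ∫_D w = 0}`, with the norm of `H¹(D)`. -/
def V (D : LipschitzDomain d) : Submodule ℝ (H1 D) := H10 D ⊓ H1MeanZero D

/-! ### The dual space `H¹(D)*`, its subspace `H`, and the Green operator -/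

/-- The bounded bilinear map `(x, y) ↦ ⟪A x, B y⟫`. -/
def pairing {X Y F : Type*} [NormedAddCommGroup X] [NormedSpace ℝ X] [NormedAddCommGroup Y]
    [NormedSpace ℝ Y] [NormedAddCommGroup F] [InnerProductSpace ℝ F]
    (A : X →L[ℝ] F) (B : Y →L[ℝ] F) : X →L[ℝ] Y →L[ℝ] ℝ :=
  ((ContinuousLinearMap.compL ℝ Y F ℝ).flip B).comp ((innerSL ℝ : F →L[ℝ] F →L[ℝ] ℝ).comp A)

theorem pairing_apply {X Y F : Type*} [NormedAddCommGroup X] [NormedSpace ℝ X]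
    [NormedAddCommGroup Y] [NormedSpace ℝ Y] [NormedAddCommGroup F] [InnerProductSpace ℝ F]
    (A : X →L[ℝ] F) (B : Y →L[ℝ] F) (x : X) (y : Y) :
    pairing A B x y = inner ℝ (A x) (B y) := rfl

/-- `H¹(D)*`, with the operator norm. -/
abbrev H1Dual (D : LipschitzDomain d) := StrongDual ℝ (H1 D)

/-- A function `w ∈ H¹(D)` regarded as an element of `H¹(D)*`: `⟨w, J⟩ = (w, J)_{L²(D)}`. -/
def toDual (D : LipschitzDomain d) : H1 D →L[ℝ] H1Dual D :=
  pairing (toL2 D) (toL2 D)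

theorem toDual_apply (D : LipschitzDomain d) (w J : H1 D) :
    toDual D w J = inner ℝ (toL2 D w) (toL2 D J) := rfl

/-- `H = {ξ ∈ H¹(D)* ; ⟨ξ, 1⟩ = 0}`. -/
def H (D : LipschitzDomain d) : Submodule ℝ (H1Dual D) where
  carrier := {ξ | ξ (one D) = 0}
  add_mem' {a b} ha hb := by
    have ha' : a (one D) = 0 := ha
    have hb' : b (one D) = 0 := hb
    simp [ha', hb']
  zero_mem' := by simp
  smul_mem' c a ha := by
    have ha' : a (one D) = 0 := ha
    simp [ha']

instance (D : LipschitzDomain d) : NormedAddCommGroup (H D) := Submodule.normedAddCommGroup (H D)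

instance (D : LipschitzDomain d) : NormedSpace ℝ (H D) := Submodule.normedSpace (H D)

/-- The weak Neumann Laplacian `w ↦ -Δw`, that is `⟨-Δw, J⟩ = (∇w, ∇J)` for all `J ∈ H¹(D)`, from
the mean zero functions in `H¹(D)` to `H`. -/
def negLaplacian (D : LipschitzDomain d) : H1MeanZero D →L[ℝ] H D :=
  ContinuousLinearMap.codRestrict
    ((pairing (grad D) (grad D)).comp (H1MeanZero D).subtypeL)
    (H D) (fun w => by
      change inner ℝ (grad D (w : H1 D)) (grad D (one D)) = 0
      rw [grad_one, inner_zero_right])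

theorem negLaplacian_apply (D : LipschitzDomain d) (w : H1MeanZero D) (J : H1 D) :
    (negLaplacian D w : H1Dual D) J = inner ℝ (grad D (w : H1 D)) (grad D J) := rfl

/-- The Green operator `G : H → {w ∈ H¹(D) ; (w, 1) = 0}`: `G ξ` is the solution `g` of
`(∇g, ∇J) = ⟨ξ, J⟩` for all `J ∈ H¹(D)`. (On a bounded connected Lipschitz domain `-Δ` is
invertible, so that `ContinuousLinearMap.inverse` is the genuine inverse.) -/
def green (D : LipschitzDomain d) : H D →L[ℝ] H1MeanZero D :=
  ContinuousLinearMap.inverse (negLaplacian D)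

/-- `ξ ↦ ∇ G ξ`, from `H` to `L²(D; ℝ^d)`. -/
def gradGreen (D : LipschitzDomain d) : H D →L[ℝ] L2Vec D :=
  ((grad D).comp (H1MeanZero D).subtypeL).comp (green D)

/-- The inner product `(ξ, η)_H = (∇Gξ, ∇Gη)_{L²(D)}` of `H`. -/
def innerH (D : LipschitzDomain d) : H D →L[ℝ] H D →L[ℝ] ℝ :=
  pairing (gradGreen D) (gradGreen D)

theorem innerH_apply (D : LipschitzDomain d) (ξ η : H D) :
    innerH D ξ η = inner ℝ (grad D (green D ξ : H1 D)) (grad D (green D η : H1 D)) := rfl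

/-! ### The triple `V ⊂ H = H* ⊂ V*` -/

/-- The inclusion `V ⊂ H`. -/
def vToH (D : LipschitzDomain d) : V D →L[ℝ] H D :=
  ContinuousLinearMap.codRestrict ((toDual D).comp (V D).subtypeL) (H D) (fun w => by
    have h : inner ℝ (toL2 D (one D)) (toL2 D (w : H1 D)) = (0 : ℝ) := w.2.2
    change inner ℝ (toL2 D (w : H1 D)) (toL2 D (one D)) = (0 : ℝ)
    rw [real_inner_comm, h])

/-- `V*`. -/
abbrev VDual (D : LipschitzDomain d) := StrongDual ℝ (V D)

/-- The inclusion `H = H* ⊂ V*`, given by `⟨ξ, g⟩ = (ξ, g)_H` for `ξ ∈ H`, `g ∈ V`. -/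
def hToVDual (D : LipschitzDomain d) : H D →L[ℝ] VDual D :=
  ((ContinuousLinearMap.compL ℝ (V D) (H D) ℝ).flip (vToH D)).comp (innerH D)

theorem hToVDual_apply (D : LipschitzDomain d) (ξ : H D) (g : V D) :
    hToVDual D ξ g = innerH D ξ (vToH D g) := rfl

/-! ### The equation -/

open Classical in
/-- The field `∇σ ∘ p ∈ L²(D; ℝ^d)` for `p ∈ L²(D; ℝ^d)`. (It is in `L²` whenever `∇σ` is continuous
and of linear growth, as it is for the functions `σ` considered below.) -/
def flux (D : LipschitzDomain d) (σ : Space d → ℝ) (p : L2Vec D) : L2Vec D :=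
  if hp : MemLp (fun x => gradient σ (p x)) 2 D.vol then hp.toLp _ else 0

/-- The operator `A_f(w) = -Δ div(∇σ(∇w + ∇f))` from `V` to `V*`, which in view of the identification
of `H` with a subspace of `V*` means `⟨A_f(w), g⟩ = -(∇σ(∇w + ∇f), ∇g)_{L²(D)}` for `g ∈ V`. -/
def opA (D : LipschitzDomain d) (σ : Space d → ℝ) (f : H1 D) (w : V D) : VDual D :=
  -((innerSL ℝ (flux D σ (grad D (w : H1 D) + grad D f))).comp ((grad D).comp (V D).subtypeL))

theorem opA_apply (D : LipschitzDomain d) (σ : Space d → ℝ) (f : H1 D) (w g : V D) :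
    opA D σ f w g = -inner ℝ (flux D σ (grad D (w : H1 D) + grad D f)) (grad D (g : H1 D)) := rfl

/-- `u ∈ L²(0, T; X)`. -/
def MemL2Time {X : Type*} [NormedAddCommGroup X] (T : ℝ) (u : ℝ → X) : Prop :=
  MemLp u 2 (volume.restrict (Icc 0 T))

/-- `u ∈ W^{1,2}([0, T]; X)` (for the continuous representative): `u` is the primitive of a function
in `L²(0, T; X)`. -/
def MemW12Time {X : Type*} [NormedAddCommGroup X] [NormedSpace ℝ X] (T : ℝ) (u : ℝ → X) : Prop :=
  ∃ u' : ℝ → X, MemL2Time T u' ∧ ∀ t ∈ Icc 0 T, u t = u 0 + ∫ s in (0 : ℝ)..t, u' s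

/-- `h : [0, T] → H¹(D)*` is a solution of `∂h/∂t = -Δ div(∇σ(∇h))` in `D`, `h = 0` outside `D`,
with initial datum `h₀`, for the auxiliary function `f`. Here `u` is `h - f` as a function with
values in `H`, and `v` is `h - f` as a function with values in `V` (for almost every time). -/
structure IsSolutionWith (D : LipschitzDomain d) (σ : Space d → ℝ) (T : ℝ) (h₀ : H1Dual D)
    (h : ℝ → H1Dual D) (f : H1 D) (u : ℝ → H D) (v : ℝ → V D) : Prop where
  mem_H10 : f ∈ H10 D
  mean_eq : h₀ (one D) = toDual D f (one D)
  coe_u : ∀ t ∈ Icc 0 T, (u t : H1Dual D) = h t - toDual D f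
  absolutelyContinuous : AbsolutelyContinuousOnInterval (fun t => hToVDual D (u t)) 0 T
  continuousOn : ContinuousOn u (Icc 0 T)
  coe_v : ∀ᵐ t ∂volume.restrict (Icc 0 T), vToH D (v t) = u t
  memL2 : MemL2Time T v
  memW12 : MemW12Time T (fun t => hToVDual D (u t))
  initial : (u 0 : H1Dual D) = h₀ - toDual D f
  equation : ∀ᵐ t ∂volume.restrict (Icc 0 T),
    HasDerivAt (fun s => hToVDual D (u s)) (opA D σ f (v t)) t

/-- `h` is a solution on `[0, T]` with initial datum `h₀`. -/
def IsSolution (D : LipschitzDomain d) (σ : Space d → ℝ) (T : ℝ) (h₀ : H1Dual D)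
    (h : ℝ → H1Dual D) : Prop :=
  ∃ f u v, IsSolutionWith D σ T h₀ h f u v

/-! ### Surface tension and its mollification -/

/-- `σ` is of class `C¹` and `c₋|u-v|² ≤ (∇σ(u) - ∇σ(v))·(u-v) ≤ c₊|u-v|²`. -/
structure IsSurfaceTension (σ : Space d → ℝ) (cm cp : ℝ) : Prop where
  contDiff : ContDiff ℝ 1 σ
  lower : ∀ u v, cm * ‖u - v‖ ^ 2 ≤ inner ℝ (gradient σ u - gradient σ v) (u - v)
  upper : ∀ u v, inner ℝ (gradient σ u - gradient σ v) (u - v) ≤ cp * ‖u - v‖ ^ 2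

/-- A mollifier: smooth, nonnegative, symmetric, supported in the open unit ball, of integral `1`. -/
structure IsMollifier (ρ : Space d → ℝ) : Prop where
  contDiff : ContDiff ℝ ∞ ρ
  nonneg : ∀ u, 0 ≤ ρ u
  symm : ∀ u, ρ (-u) = ρ u
  tsupport_subset : tsupport ρ ⊆ Metric.ball 0 1
  integral_eq_one : ∫ u, ρ u = 1

/-- `ρ_δ(u) = δ^{-d} ρ(δ^{-1} u)`. -/
def rescale (ρ : Space d → ℝ) (δ : ℝ) (u : Space d) : ℝ := (δ ^ d)⁻¹ * ρ (δ⁻¹ • u)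

/-- `σ^δ = σ * ρ_δ`. -/
def mollify (σ ρ : Space d → ℝ) (δ : ℝ) : Space d → ℝ := σ ⋆ rescale ρ δ

end InterfacePDE

end

/-! The proof is an energy estimate in the norm of `H`, and it gives a linear rate. Let `w = h -
h^δ`. The auxiliary functions `f`, `f'` of the two solutions have equal means, so `f - f'` lies in
`V`, and `w` takes values in `V` for almost every time, with `w(0) = 0`. With `p = ∇h` and `q =
∇h^δ`, so that `∇w = p - q`, testing the difference of the equations with `w` in the triple `V ⊂ H ⊂
V*` gives formally `d/dt ‖w‖_H² = -2 (∇σ(p) - ∇σ^δ(q), p - q)`.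

Convexity and the upper bound make `∇σ` Lipschitz with constant `2 c₊`
(`IsSurfaceTension.norm_gradient_sub_le`), hence `|∇σ^δ - ∇σ| ≤ 2 c₊ δ` everywhere
(`IsSurfaceTension.norm_gradient_mollify_sub_le`). Strong monotonicity of `∇σ` absorbs this error:
pointwise the inner product is at least `c₋ s² - 2 c₊ δ s ≥ -c₊² δ² / c₋` with `s = |p - q|`
(`IsSurfaceTension.neg_le_inner_flux_sub`). Integration in time gives `‖w(t)‖_H² ≤ 2 T |D| c₊² δ² /
c₋`, and the norm of `H` dominates that of `H¹(D)*` (`norm_le_norm_gradGreen`).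

Two points need real work. First, `green` is an honest inverse of the Neumann Laplacian only if the
Poincaré inequality holds on `D`. It is derived from translation estimates: directly on balls, near
the boundary by pushing `D` into itself, and globally by gluing overlapping pieces along the
connected set `D`. Neither density of smooth functions nor Rellich compactness enters. Second, the
formal energy computation is justified, as an inequality, by backward time differences
(`norm_sq_le_two_mul_integral`). -/

noncomputable section

namespace InterfacePDE

variable {d : ℕ}

/-! ### Difference quotients of functions in `H¹(D)` -/

section Translate

variable {D : LipschitzDomain d}

/-- The extension by zero of a function in `H¹(D)`. -/
def extend (D : LipschitzDomain d) (u : H1 D) : Space d → ℝ := D.carrier.indicator (toL2 D u)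

theorem measurable_extend (u : H1 D) : Measurable (extend D u) :=
  (Lp.stronglyMeasurable (toL2 D u)).measurable.indicator D.isOpen.measurableSet

theorem memLp_extend (u : H1 D) : MemLp (extend D u) 2 volume :=
  (memLp_indicator_iff_restrict D.isOpen.measurableSet).2 (Lp.memLp (toL2 D u))

theorem isWeakGradient_grad (u : H1 D) : IsWeakGradient D (toL2 D u) (grad D u) := u.2

theorem IsTest.comp_sub {φ : Space d → ℝ} (hφ : ContDiff ℝ ∞ φ) (hc : HasCompactSupport φ)
    {a : Space d} (ha : ∀ x ∈ tsupport φ, x + a ∈ D.carrier) :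
    IsTest D (fun x => φ (x - a)) where
  contDiff := hφ.comp (contDiff_id.sub contDiff_const)
  hasCompactSupport := hc.comp_homeomorph (Homeomorph.subRight a)
  tsupport_subset := by
    have h : tsupport (fun x => φ (x - a)) = (Homeomorph.subRight a) ⁻¹' tsupport φ :=
      tsupport_comp_eq_preimage φ (Homeomorph.subRight a)
    rw [h]
    intro x hx
    simpa using ha _ hx

theorem norm_toLp_smul_le {φ : Space d → ℝ} (hφ : MemLp φ 2 D.vol) (a : Space d)
    (hφa : MemLp (fun x => φ x • a) 2 D.vol) :
    ‖hφa.toLp‖ ≤ ‖a‖ * (eLpNorm φ 2 D.vol).toReal := by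
  rw [Lp.norm_toLp]
  have h := eLpNorm_le_nnreal_smul_eLpNorm_of_ae_le_mul (μ := D.vol) (f := fun x => φ x • a)
    (g := φ) (c := ‖a‖₊) (Eventually.of_forall fun x => by rw [nnnorm_smul, mul_comm]) 2
  refine (ENNReal.toReal_mono (ENNReal.mul_ne_top (by simp) hφ.2.ne) h).trans_eq ?_
  rw [ENNReal.toReal_mul]
  simp

theorem integral_mul_fderiv_eq (u : H1 D) {φ : Space d → ℝ} (hφ : IsTest D φ) (a : Space d) :
    ∫ x in D.carrier, toL2 D u x * fderiv ℝ φ x a =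
      -∫ x in D.carrier, inner ℝ (grad D u x) (φ x • a) := by
  have ha : a = ∑ i, a i • EuclideanSpace.single i (1 : ℝ) := by
    ext j
    simp [Finset.sum_apply, Pi.single_apply]
  have e1 : ∀ x, toL2 D u x * fderiv ℝ φ x a =
      ∑ i, a i * (toL2 D u x * fderiv ℝ φ x (EuclideanSpace.single i 1)) := by
    intro x
    conv_lhs => rw [ha]
    rw [map_sum, Finset.mul_sum]
    refine Finset.sum_congr rfl fun i _ => ?_
    rw [map_smul, smul_eq_mul]
    ring
  have e2 : ∀ x, inner ℝ (grad D u x) (φ x • a) = ∑ i, a i * (grad D u x i * φ x) := by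
    intro x
    rw [PiLp.inner_apply]
    refine Finset.sum_congr rfl fun i _ => ?_
    simp
    ring
  simp only [e1, e2]
  rw [integral_finsetSum, integral_finsetSum, ← Finset.sum_neg_distrib]
  · refine Finset.sum_congr rfl fun i _ => ?_
    rw [integral_const_mul, integral_const_mul, isWeakGradient_grad u φ hφ i, mul_neg]
  · exact fun i _ => ((memLp_coord (grad D u) i).integrable_mul hφ.memLp).const_mul _
  · exact fun i _ => ((Lp.memLp (toL2 D u)).integrable_mul (hφ.memLp_deriv i)).const_mul _

theorem abs_integral_mul_fderiv_le (u : H1 D) {φ : Space d → ℝ} (hφ : IsTest D φ) (a : Space d) :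
    |∫ x in D.carrier, toL2 D u x * fderiv ℝ φ x a| ≤
      ‖a‖ * ‖grad D u‖ * (eLpNorm φ 2 volume).toReal := by
  have hm : MemLp (fun x => φ x • a) 2 D.vol := by
    simpa using hφ.memLp.continuousLinearMap_comp
      ((ContinuousLinearMap.id ℝ ℝ).smulRight a)
  have e : ∫ x in D.carrier, inner ℝ (grad D u x) (φ x • a) = inner ℝ (grad D u) hm.toLp := by
    rw [L2.inner_def]
    refine integral_congr_ae ?_
    filter_upwards [hm.coeFn_toLp] with x hx
    rw [hx]
  rw [integral_mul_fderiv_eq u hφ a, e, abs_neg]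
  have hφ' : MemLp φ 2 volume :=
    hφ.contDiff.continuous.memLp_of_hasCompactSupport hφ.hasCompactSupport
  calc |inner ℝ (grad D u) hm.toLp| ≤ ‖grad D u‖ * ‖hm.toLp‖ := abs_real_inner_le_norm _ _
    _ ≤ ‖grad D u‖ * (‖a‖ * (eLpNorm φ 2 D.vol).toReal) := by
        gcongr
        exact norm_toLp_smul_le hφ.memLp a hm
    _ ≤ ‖grad D u‖ * (‖a‖ * (eLpNorm φ 2 volume).toReal) := by
        gcongr
        · exact hφ'.2.ne
        · exact Measure.restrict_le_self
    _ = _ := by ring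

theorem integrable_toL2 (u : H1 D) : Integrable (toL2 D u) D.vol :=
  (Lp.memLp (toL2 D u)).integrable (by norm_num)

/-- The difference quotients of `u ∈ H¹(D)`, tested against a smooth function, are controlled by
the gradient of `u`. -/
theorem abs_integral_translate_sub_le (u : H1 D) {φ : Space d → ℝ} (hφ : ContDiff ℝ ∞ φ)
    (hc : HasCompactSupport φ) {a : Space d}
    (ha : ∀ x ∈ tsupport φ, ∀ τ ∈ Icc (0 : ℝ) 1, x + τ • a ∈ D.carrier) :
    |(∫ x in D.carrier, toL2 D u x * φ (x - a)) - ∫ x in D.carrier, toL2 D u x * φ x| ≤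
      ‖a‖ * ‖grad D u‖ * (eLpNorm φ 2 volume).toReal := by
  have hd : Differentiable ℝ φ := hφ.differentiable (by simp)
  have hcf : Continuous (fderiv ℝ φ) := hφ.continuous_fderiv (by simp)
  obtain ⟨C, hC⟩ := hcf.bounded_above_of_compact_support (hc.fderiv ℝ)
  -- The translation falls on the smooth `φ`, so `k` is differentiable although `u` is only Sobolev;
  -- a bound on `k'` over `[0, 1]` bounds `k 1 - k 0`.
  set k : ℝ → ℝ := fun τ => ∫ x in D.carrier, toL2 D u x * φ (x - τ • a) with hk
  set k' : ℝ → ℝ := fun τ => ∫ x in D.carrier, toL2 D u x * fderiv ℝ φ (x - τ • a) (-a) with hk'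
  have hum : AEStronglyMeasurable (toL2 D u) D.vol := (integrable_toL2 u).aestronglyMeasurable
  have hder : ∀ τ, HasDerivAt k (k' τ) τ := by
    intro τ
    obtain ⟨M, hM⟩ := hφ.continuous.bounded_above_of_compact_support hc
    refine (hasDerivAt_integral_of_dominated_loc_of_deriv_le
      (F := fun τ x => toL2 D u x * φ (x - τ • a))
      (F' := fun τ x => toL2 D u x * fderiv ℝ φ (x - τ • a) (-a))
      (bound := fun x => ‖toL2 D u x‖ * (C * ‖a‖)) (s := univ) univ_mem ?_ ?_ ?_ ?_ ?_ ?_).2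
    · exact Eventually.of_forall fun t => hum.mul
        (hφ.continuous.comp (continuous_sub_right _)).aestronglyMeasurable
    · refine (integrable_toL2 u).mul_bdd (c := M)
        (hφ.continuous.comp (continuous_sub_right _)).aestronglyMeasurable
        (Eventually.of_forall fun x => hM _)
    · exact hum.mul ((hcf.comp (continuous_sub_right _)).clm_apply
        continuous_const).aestronglyMeasurable
    · refine Eventually.of_forall fun x t _ => ?_
      rw [norm_mul]
      refine mul_le_mul_of_nonneg_left ?_ (norm_nonneg _)
      refine ((fderiv ℝ φ (x - t • a)).le_opNorm (-a)).trans ?_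
      rw [norm_neg]
      exact mul_le_mul_of_nonneg_right (hC _) (norm_nonneg _)
    · exact (integrable_toL2 u).norm.mul_const _
    · refine Eventually.of_forall fun x t _ => ?_
      have h1 : HasDerivAt (fun t : ℝ => x - t • a) (-a) t := by
        simpa using ((hasDerivAt_id t).smul_const a).const_sub x
      exact ((hd (x - t • a)).hasFDerivAt.comp_hasDerivAt t h1).const_mul _
  have hbound : ∀ τ ∈ Icc (0 : ℝ) 1,
      ‖k' τ‖ ≤ ‖a‖ * ‖grad D u‖ * (eLpNorm φ 2 volume).toReal := by
    intro τ hτ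
    -- The weak gradient can be used at time `τ` because the shifted support stays inside `D`: this
    -- is where the whole segment from `x` to `x + a` is needed.
    have ht : IsTest D (fun x => φ (x - τ • a)) :=
      IsTest.comp_sub hφ hc fun x hx => ha x hx τ hτ
    have h1 := abs_integral_mul_fderiv_le u ht (-a)
    have h2 : eLpNorm (fun x => φ (x - τ • a)) 2 volume = eLpNorm φ 2 volume :=
      eLpNorm_comp_measurePreserving hφ.continuous.aestronglyMeasurable
        (measurePreserving_sub_right volume (τ • a))
    rw [h2, norm_neg] at h1
    refine le_of_eq_of_le ?_ h1
    rw [Real.norm_eq_abs, hk']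
    simp only [fderiv_comp_sub]
  have h := norm_image_sub_le_of_norm_deriv_le_segment_01' (f := k)
    (fun τ _ => (hder τ).hasDerivWithinAt) (fun τ hτ => hbound τ ⟨hτ.1, hτ.2.le⟩)
  simpa [hk] using h

/-- An `L²` function whose pairing with all test functions in an open set `U` is bounded by their
`L²` norm. -/
theorem eLpNorm_restrict_le_of_forall_test {U : Set (Space d)} (hU : IsOpen U) {v : Space d → ℝ}
    (hv : MemLp v 2 volume) {M : ℝ} (hM : 0 ≤ M)
    (h : ∀ φ : Space d → ℝ, ContDiff ℝ ∞ φ → HasCompactSupport φ → tsupport φ ⊆ U →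
      |∫ x, v x * φ x| ≤ M * (eLpNorm φ 2 volume).toReal) :
    eLpNorm v 2 (volume.restrict U) ≤ ENNReal.ofReal M := by
  let μ : Measure (Space d) := volume.restrict U
  have hvU : MemLp v 2 μ := hv.restrict U
  let S : Submodule ℝ (Lp ℝ 2 μ) :=
    { carrier := {f | ∃ φ : Space d → ℝ, ContDiff ℝ ∞ φ ∧ HasCompactSupport φ ∧ tsupport φ ⊆ U ∧
        f =ᵐ[μ] φ}
      add_mem' := by
        rintro f g ⟨φ, h1, h2, h3, h4⟩ ⟨ψ, h1', h2', h3', h4'⟩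
        refine ⟨φ + ψ, h1.add h1', h2.add h2', (tsupport_add φ ψ).trans (union_subset h3 h3'), ?_⟩
        exact (Lp.coeFn_add f g).trans (h4.add h4')
      zero_mem' := ⟨0, contDiff_const, HasCompactSupport.zero, by simp [tsupport], Lp.coeFn_zero _ _ _⟩
      smul_mem' := by
        rintro c f ⟨φ, h1, h2, h3, h4⟩
        refine ⟨c • φ, h1.const_smul c, h2.smul_left (f := fun _ => c),
          (tsupport_smul_subset_right (fun _ => c) φ).trans h3, ?_⟩
        exact (Lp.coeFn_smul c f).trans (h4.const_smul c) }
  -- Test functions are dense in `L²(U)`: a function orthogonal to all of them vanishes almost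
  -- everywhere. The assumed bound then passes to the closure and may be applied to `v` itself,
  -- giving `‖v‖² ≤ M ‖v‖`.
  have hS : S.topologicalClosure = ⊤ := by
    rw [Submodule.topologicalClosure_eq_top_iff, Submodule.eq_bot_iff]
    intro f hf
    have hloc : LocallyIntegrableOn f U volume := by
      have := (Lp.memLp f).locallyIntegrable (by norm_num)
      exact locallyIntegrableOn_of_locallyIntegrable_restrict this
    have h0 := hU.ae_eq_zero_of_integral_contDiff_smul_eq_zero hloc (by
      intro g hg hgc hgU
      have hgm : MemLp g 2 μ :=
        (hg.continuous.memLp_of_hasCompactSupport hgc).restrict U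
      have h1 : inner ℝ hgm.toLp f = (0 : ℝ) :=
        hf _ ⟨g, hg, hgc, hgU, hgm.coeFn_toLp⟩
      rw [L2.inner_def] at h1
      rw [← h1, ← setIntegral_eq_integral_of_forall_compl_eq_zero (s := U)]
      · refine integral_congr_ae ?_
        filter_upwards [hgm.coeFn_toLp] with x hx
        rw [hx]
        simp [mul_comm]
      · intro x hx
        rw [image_eq_zero_of_notMem_tsupport (fun h' => hx (hgU h')), zero_smul])
    rw [Lp.eq_zero_iff_ae_eq_zero]
    exact (ae_restrict_iff' hU.measurableSet).2 h0
  have hclosed : IsClosed {f : Lp ℝ 2 μ | |inner ℝ hvU.toLp f| ≤ M * ‖f‖} :=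
    isClosed_le (innerSL ℝ hvU.toLp).continuous.abs (continuous_norm.const_mul M)
  have hsub : (S : Set (Lp ℝ 2 μ)) ⊆ {f : Lp ℝ 2 μ | |inner ℝ hvU.toLp f| ≤ M * ‖f‖} := by
    rintro f ⟨φ, h1, h2, h3, h4⟩
    have h5 := h φ h1 h2 h3
    have e1 : inner ℝ hvU.toLp f = ∫ x, v x * φ x := by
      rw [L2.inner_def, ← setIntegral_eq_integral_of_forall_compl_eq_zero (s := U)
        (f := fun x => v x * φ x)]
      · refine integral_congr_ae ?_
        filter_upwards [hvU.coeFn_toLp, h4] with x hx hx'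
        rw [hx, hx']
        simp [mul_comm]
      · intro x hx
        rw [image_eq_zero_of_notMem_tsupport (fun h' => hx (h3 h')), mul_zero]
    have e2 : ‖f‖ = (eLpNorm φ 2 volume).toReal := by
      rw [Lp.norm_def, eLpNorm_congr_ae h4,
        eLpNorm_restrict_eq_of_support_subset ((subset_tsupport φ).trans h3)]
    change |inner ℝ hvU.toLp f| ≤ M * ‖f‖
    rw [e1, e2]
    exact h5
  have hmem : hvU.toLp ∈ closure (S : Set (Lp ℝ 2 μ)) := by
    rw [← Submodule.topologicalClosure_coe, hS]
    trivial
  have h6 : |inner ℝ hvU.toLp hvU.toLp| ≤ M * ‖hvU.toLp‖ := closure_minimal hsub hclosed hmem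
  rw [real_inner_self_eq_norm_sq, abs_of_nonneg (by positivity)] at h6
  have h7 : ‖hvU.toLp‖ ≤ M := by
    by_contra hlt
    have hlt' := not_le.1 hlt
    nlinarith [norm_nonneg hvU.toLp]
  rw [Lp.norm_toLp] at h7
  exact (ENNReal.le_ofReal_iff_toReal_le hvU.2.ne hM).2 h7

/-- The translation estimate for functions in `H¹(D)`. -/
theorem lintegral_translate_sub_le (u : H1 D) {U : Set (Space d)} (hU : IsOpen U) {a : Space d}
    (ha : ∀ x ∈ U, ∀ τ ∈ Icc (0 : ℝ) 1, x + τ • a ∈ D.carrier) :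
    ∫⁻ x in U, ‖extend D u (x + a) - extend D u x‖ₑ ^ 2 ≤ ‖a‖ₑ ^ 2 * ‖grad D u‖ₑ ^ 2 := by
  have hm : MemLp (fun x => extend D u (x + a)) 2 volume :=
    (memLp_extend u).comp_measurePreserving (measurePreserving_add_right volume a)
  have key := eLpNorm_restrict_le_of_forall_test hU (hm.sub (memLp_extend u))
    (M := ‖a‖ * ‖grad D u‖) (by positivity) (by
      intro φ h1 h2 h3
      have h4 := abs_integral_translate_sub_le u h1 h2 (a := a) fun x hx => ha x (h3 hx)
      refine le_of_eq_of_le (congrArg abs ?_) h4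
      have hφ : MemLp φ 2 volume := h1.continuous.memLp_of_hasCompactSupport h2
      have e1 : ∫ x in D.carrier, toL2 D u x * φ (x - a) = ∫ x, extend D u (x + a) * φ x := by
        rw [← integral_indicator D.isOpen.measurableSet,
          ← integral_add_right_eq_self _ a]
        refine integral_congr_ae (Eventually.of_forall fun x => ?_)
        simp [extend, indicator_mul_left]
      have e2 : ∫ x in D.carrier, toL2 D u x * φ x = ∫ x, extend D u x * φ x := by
        rw [← integral_indicator D.isOpen.measurableSet]
        refine integral_congr_ae (Eventually.of_forall fun x => ?_)
        simp [extend, indicator_mul_left]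
      have i1 : Integrable (fun x => extend D u (x + a) * φ x) := hm.integrable_mul hφ
      have i2 : Integrable (fun x => extend D u x * φ x) := (memLp_extend u).integrable_mul hφ
      rw [e1, e2, ← integral_sub i1 i2]
      refine integral_congr_ae (Eventually.of_forall fun x => ?_)
      simp [sub_mul])
  have e := eLpNorm_nnreal_pow_eq_lintegral (μ := volume.restrict U) (p := 2)
    (f := (fun x => extend D u (x + a)) - extend D u) two_ne_zero
  have e' : ∫⁻ x in U, ‖extend D u (x + a) - extend D u x‖ₑ ^ 2 =
      eLpNorm ((fun x => extend D u (x + a)) - extend D u) 2 (volume.restrict U) ^ 2 := by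
    simpa using e.symm
  rw [e', ← mul_pow]
  refine pow_le_pow_left' (key.trans_eq ?_) 2
  rw [ENNReal.ofReal_mul (norm_nonneg _), ofReal_norm, ofReal_norm]

end Translate

/-! ### The Poincaré inequality -/

section Poincare

variable {D : LipschitzDomain d}

/-- The oscillation of the functions `u ∈ H¹(D)` on the part `U` of `D` is controlled by
their gradients on `D`. -/
def IsPoincareOn (D : LipschitzDomain d) (U : Set (Space d)) : Prop :=
  ∃ C : ℝ≥0, ∀ u : H1 D, ∃ c : ℝ,
    ∫⁻ x in U, ‖extend D u x - c‖ₑ ^ 2 ≤ C * ‖grad D u‖ₑ ^ 2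

theorem enorm_sub_sq_le (a b c : ℝ) : ‖a - c‖ₑ ^ 2 ≤ 2 * ‖a - b‖ₑ ^ 2 + 2 * ‖b - c‖ₑ ^ 2 := by
  have h : ‖a - c‖ ^ 2 ≤ 2 * ‖a - b‖ ^ 2 + 2 * ‖b - c‖ ^ 2 := by
    simp only [Real.norm_eq_abs, sq_abs]
    nlinarith [sq_nonneg (a - b - (b - c))]
  have h' : ‖a - c‖₊ ^ 2 ≤ 2 * ‖a - b‖₊ ^ 2 + 2 * ‖b - c‖₊ ^ 2 := by
    rw [← NNReal.coe_le_coe]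
    push_cast
    exact h
  simp only [enorm_eq_nnnorm]
  exact_mod_cast h'

theorem enorm_sub_comm (a b : ℝ) : ‖a - b‖ₑ = ‖b - a‖ₑ := by
  rw [← enorm_neg, neg_sub]

theorem measurable_enorm_extend_sub (u : H1 D) (c : ℝ) :
    Measurable fun x => ‖extend D u x - c‖ₑ ^ 2 :=
  ((measurable_extend u).sub_const c).enorm.pow_const 2

/-- Split `u(x) - c` as `(u(x) - u(x + a)) + (u(x + a) - c)`: the translation estimate controls the
first term, and the second is the oscillation on `B` after a shift. The same constant `c` serves for
`U`. -/
theorem IsPoincareOn.of_translate {U B : Set (Space d)} (hU : IsOpen U) (hB : IsPoincareOn D B)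
    {a : Space d} (ha : ∀ x ∈ U, ∀ τ ∈ Icc (0 : ℝ) 1, x + τ • a ∈ D.carrier)
    (hUB : ∀ x ∈ U, x + a ∈ B) : IsPoincareOn D U := by
  obtain ⟨C, hC⟩ := hB
  refine ⟨2 * ‖a‖₊ ^ 2 + 2 * C, fun u => ?_⟩
  obtain ⟨c, hc⟩ := hC u
  refine ⟨c, ?_⟩
  have hm : Measurable fun x => ‖extend D u (x + a) - c‖ₑ ^ 2 :=
    (measurable_enorm_extend_sub u c).comp (measurable_add_const a)
  have h1 : ∫⁻ x in U, ‖extend D u (x + a) - c‖ₑ ^ 2 ≤ C * ‖grad D u‖ₑ ^ 2 := by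
    refine le_trans ?_ hc
    have e : ∫⁻ x in (fun x => x + a) ⁻¹' B, ‖extend D u (x + a) - c‖ₑ ^ 2 =
        ∫⁻ x in B, ‖extend D u x - c‖ₑ ^ 2 :=
      (measurePreserving_add_right volume a).setLIntegral_comp_preimage_emb
        (measurableEmbedding_addRight a) (fun x => ‖extend D u x - c‖ₑ ^ 2) B
    rw [← e]
    exact lintegral_mono_set hUB
  calc ∫⁻ x in U, ‖extend D u x - c‖ₑ ^ 2
      ≤ ∫⁻ x in U, (2 * ‖extend D u (x + a) - extend D u x‖ₑ ^ 2 +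
          2 * ‖extend D u (x + a) - c‖ₑ ^ 2) := by
        refine lintegral_mono fun x => ?_
        rw [enorm_sub_comm (extend D u (x + a)) (extend D u x)]
        exact enorm_sub_sq_le _ _ _
    _ = 2 * (∫⁻ x in U, ‖extend D u (x + a) - extend D u x‖ₑ ^ 2) +
          2 * ∫⁻ x in U, ‖extend D u (x + a) - c‖ₑ ^ 2 := by
        rw [lintegral_add_right _ (hm.const_mul 2), lintegral_const_mul' _ _ (by simp),
          lintegral_const_mul' _ _ (by simp)]
    _ ≤ 2 * (‖a‖ₑ ^ 2 * ‖grad D u‖ₑ ^ 2) + 2 * (C * ‖grad D u‖ₑ ^ 2) := by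
        gcongr
        exact lintegral_translate_sub_le u hU ha
    _ = _ := by
        push_cast
        rw [enorm_eq_nnnorm a]
        ring

/-- Substituting `x = y + a` and exchanging the integrals turns a double integral over `B × B` into
an integral over displacements, to which the translation estimate applies for each `a`. -/
theorem lintegral_lintegral_eq_lintegral_translate {F : Space d × Space d → ENNReal}
    (hF : Measurable F) {B : Set (Space d)} (hB : MeasurableSet B) :
    ∫⁻ y in B, ∫⁻ x in B, F (y, x) = ∫⁻ a, ∫⁻ y in B ∩ (fun y => y + a) ⁻¹' B, F (y, y + a) := by
  let S : Set (Space d × Space d) := Prod.fst ⁻¹' B ∩ (fun p => p.1 + p.2) ⁻¹' B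
  let Φ : Space d → Space d → ENNReal := fun y a =>
    S.indicator (fun p => F (p.1, p.1 + p.2)) (y, a)
  have hΦ : Measurable (Function.uncurry Φ) :=
    (hF.comp (measurable_fst.prodMk (measurable_fst.add measurable_snd))).indicator
      ((measurable_fst hB).inter ((measurable_fst.add measurable_snd) hB))
  have e1 : ∫⁻ y in B, ∫⁻ x in B, F (y, x) = ∫⁻ y, ∫⁻ a, Φ y a := by
    rw [← lintegral_indicator hB]
    refine lintegral_congr fun y => ?_
    by_cases hy : y ∈ B
    · rw [indicator_of_mem hy, ← lintegral_indicator hB, ← lintegral_add_left_eq_self _ y]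
      refine lintegral_congr fun a => ?_
      by_cases ha : y + a ∈ B
      · rw [indicator_of_mem ha]
        have hm : (y, a) ∈ S := ⟨hy, ha⟩
        exact (indicator_of_mem hm fun p => F (p.1, p.1 + p.2)).symm
      · rw [indicator_of_notMem ha]
        exact (indicator_of_notMem (s := S) (fun h => ha h.2) _).symm
    · rw [indicator_of_notMem hy, lintegral_eq_zero_of_ae_eq_zero]
      exact Eventually.of_forall fun a => indicator_of_notMem (s := S) (fun h => hy h.1) _
  rw [e1, lintegral_lintegral_swap hΦ.aemeasurable]
  refine lintegral_congr fun a => ?_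
  rw [← lintegral_indicator (hB.inter ((measurable_add_const a) hB))]
  rfl

/-- The double integral of `|u(x) - u(y)|²` over the ball is bounded displacement by displacement.
Only `|a| < 2r` contributes, and convexity keeps the segments in the ball. -/
theorem isPoincareOn_ball {x₀ : Space d} {r : ℝ} (hr : 0 < r)
    (hB : Metric.ball x₀ r ⊆ D.carrier) : IsPoincareOn D (Metric.ball x₀ r) := by
  set B := Metric.ball x₀ r with hBdef
  set B' : Set (Space d) := Metric.ball 0 (2 * r) with hB'
  have hv0 : volume B ≠ 0 := (Metric.measure_ball_pos volume x₀ hr).ne'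
  have hvt : volume B ≠ ⊤ := measure_ball_lt_top.ne
  have hvt' : volume B' ≠ ⊤ := measure_ball_lt_top.ne
  have hBm : MeasurableSet B := measurableSet_ball
  refine ⟨(volume B).toNNReal⁻¹ * ((volume B').toNNReal * (2 * r).toNNReal ^ 2), fun u => ?_⟩
  have hmeas : Measurable fun p : Space d × Space d =>
      ‖extend D u p.2 - extend D u p.1‖ₑ ^ 2 :=
    (((measurable_extend u).comp measurable_snd).sub
      ((measurable_extend u).comp measurable_fst)).enorm.pow_const 2
  have htr : ∀ a : Space d, ∫⁻ y in B ∩ (fun y => y + a) ⁻¹' B,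
      ‖extend D u (y + a) - extend D u y‖ₑ ^ 2 ≤
        B'.indicator (fun _ => (ENNReal.ofReal (2 * r)) ^ 2 * ‖grad D u‖ₑ ^ 2) a := by
    intro a
    by_cases haB : a ∈ B'
    · rw [indicator_of_mem haB]
      refine (lintegral_translate_sub_le u (Metric.isOpen_ball.inter
        (Metric.isOpen_ball.preimage (continuous_add_const a))) ?_).trans ?_
      · exact fun x hx τ hτ => hB ((convex_ball x₀ r).add_smul_mem hx.1 hx.2 hτ)
      · gcongr
        rw [← ofReal_norm]
        exact ENNReal.ofReal_le_ofReal (mem_ball_zero_iff.1 haB).le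
    · have hUe : B ∩ (fun y => y + a) ⁻¹' B = ∅ := by
        refine eq_empty_of_forall_notMem fun y hy => haB ?_
        have h3 : dist y x₀ < r := hy.1
        have h4 : dist (y + a) x₀ < r := hy.2
        rw [hB', mem_ball_zero_iff]
        have h5 := dist_triangle_right (y + a) y x₀
        rw [dist_self_add_left] at h5
        linarith
      rw [hUe, Measure.restrict_empty, lintegral_zero_measure]
      exact zero_le
  have key : ∫⁻ y in B, ∫⁻ x in B, ‖extend D u x - extend D u y‖ₑ ^ 2 ≤
      volume B' * ((ENNReal.ofReal (2 * r)) ^ 2 * ‖grad D u‖ₑ ^ 2) := by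
    refine (lintegral_lintegral_eq_lintegral_translate hmeas hBm).trans_le
      ((lintegral_mono htr).trans_eq ?_)
    rw [lintegral_indicator measurableSet_ball, lintegral_const, Measure.restrict_apply_univ,
      mul_comm]
  have hinner : Measurable fun y => ∫⁻ x in B, ‖extend D u x - extend D u y‖ₑ ^ 2 :=
    hmeas.lintegral_prod_right'
  -- Some `y` does no worse than the average over `B`; the value of `u` at that point serves as the
  -- constant `c`.
  obtain ⟨y, -, hy⟩ := exists_le_setLAverage (μ := volume) (s := B)
    (f := fun y => ∫⁻ x in B, ‖extend D u x - extend D u y‖ₑ ^ 2) hv0 hvt hinner.aemeasurable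
  refine ⟨extend D u y, hy.trans ?_⟩
  rw [setLAverage_eq, ENNReal.div_eq_inv_mul]
  refine (mul_le_mul_right key _).trans_eq ?_
  have hne : (volume B).toNNReal ≠ 0 := by
    simp [ENNReal.toNNReal_eq_zero_iff, hv0, hvt]
  push_cast
  rw [ENNReal.coe_inv hne, ENNReal.coe_toNNReal hvt, ENNReal.coe_toNNReal hvt']
  rw [ENNReal.ofReal]
  ring

/-- On the overlap, `u` is close to both constants `c` and `c'`, which bounds `|c' - c|` because the
overlap has positive measure. Then `c` can replace `c'` on `U'`. -/
theorem IsPoincareOn.union {U U' : Set (Space d)} (h : IsPoincareOn D U) (h' : IsPoincareOn D U')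
    (hU : U ⊆ D.carrier) (hU' : U' ⊆ D.carrier)
    (hi : volume (U ∩ U') ≠ 0) : IsPoincareOn D (U ∪ U') := by
  obtain ⟨C, hC⟩ := h
  obtain ⟨C', hC'⟩ := h'
  have hfin : ∀ {W : Set (Space d)}, W ⊆ D.carrier → volume W ≠ ⊤ := fun hW =>
    ((measure_mono hW).trans_lt D.isBounded.measure_lt_top).ne
  have hvi : volume (U ∩ U') ≠ ⊤ := hfin (inter_subset_left.trans hU)
  refine ⟨C + (2 * C' + 2 * ((volume (U ∩ U')).toNNReal⁻¹ * (2 * C + 2 * C') *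
    (volume U').toNNReal)), fun u => ?_⟩
  obtain ⟨c, hc⟩ := hC u
  obtain ⟨c', hc'⟩ := hC' u
  refine ⟨c, ?_⟩
  set G := ‖grad D u‖ₑ ^ 2 with hG
  have hcc : ‖c' - c‖ₑ ^ 2 * volume (U ∩ U') ≤ (2 * C + 2 * C') * G := by
    calc ‖c' - c‖ₑ ^ 2 * volume (U ∩ U') = ∫⁻ x in U ∩ U', ‖c' - c‖ₑ ^ 2 := by
          rw [lintegral_const, Measure.restrict_apply_univ]
      _ ≤ ∫⁻ x in U ∩ U', (2 * ‖extend D u x - c'‖ₑ ^ 2 + 2 * ‖extend D u x - c‖ₑ ^ 2) := by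
          refine lintegral_mono fun x => ?_
          rw [enorm_sub_comm (extend D u x) c']
          exact enorm_sub_sq_le _ _ _
      _ = 2 * (∫⁻ x in U ∩ U', ‖extend D u x - c'‖ₑ ^ 2) +
          2 * ∫⁻ x in U ∩ U', ‖extend D u x - c‖ₑ ^ 2 := by
          rw [lintegral_add_right _ ((measurable_enorm_extend_sub u c).const_mul 2),
            lintegral_const_mul' _ _ (by simp), lintegral_const_mul' _ _ (by simp)]
      _ ≤ 2 * (C' * G) + 2 * (C * G) := by
          gcongr
          · exact (lintegral_mono_set inter_subset_right).trans hc'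
          · exact (lintegral_mono_set inter_subset_left).trans hc
      _ = _ := by ring
  have hcc' : ‖c' - c‖ₑ ^ 2 ≤ (volume (U ∩ U'))⁻¹ * ((2 * C + 2 * C') * G) := by
    rw [mul_comm] at hcc
    rwa [← ENNReal.div_eq_inv_mul, ENNReal.le_div_iff_mul_le (Or.inl hi) (Or.inl hvi), mul_comm]
  calc ∫⁻ x in U ∪ U', ‖extend D u x - c‖ₑ ^ 2
      ≤ (∫⁻ x in U, ‖extend D u x - c‖ₑ ^ 2) + ∫⁻ x in U', ‖extend D u x - c‖ₑ ^ 2 :=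
        lintegral_union_le _ _ _
    _ ≤ C * G + ∫⁻ x in U', (2 * ‖extend D u x - c'‖ₑ ^ 2 + 2 * ‖c' - c‖ₑ ^ 2) := by
        gcongr
        exact enorm_sub_sq_le _ _ _
    _ = C * G + (2 * (∫⁻ x in U', ‖extend D u x - c'‖ₑ ^ 2) +
          2 * ‖c' - c‖ₑ ^ 2 * volume U') := by
        rw [lintegral_add_right _ measurable_const, lintegral_const_mul' _ _ (by simp),
          lintegral_const, Measure.restrict_apply_univ]
    _ ≤ C * G + (2 * (C' * G) +
          2 * ((volume (U ∩ U'))⁻¹ * ((2 * C + 2 * C') * G)) * volume U') := by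
        gcongr
    _ = _ := by
        have hne : (volume (U ∩ U')).toNNReal ≠ 0 := by
          simp [ENNReal.toNNReal_eq_zero_iff, hi, hvi]
        push_cast
        rw [ENNReal.coe_inv hne, ENNReal.coe_toNNReal hvi, ENNReal.coe_toNNReal (hfin hU')]
        ring

/-- Near a boundary point, the domain can be pushed inside itself. -/
theorem exists_isPoincareOn_of_mem_frontier {p : Space d} (hp : p ∈ frontier D.carrier) :
    ∃ r > 0, IsPoincareOn D (Metric.ball p r ∩ D.carrier) := by
  obtain ⟨n, hn, r, hr, K, γ, hγ, hD⟩ := D.hasLipschitzBoundary p hp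
  set P := (Submodule.span ℝ {n})ᗮ.orthogonalProjectionOnto with hP
  have hPn : P n = 0 := Submodule.orthogonalProjectionOnto_orthogonalComplement_singleton_eq_zero n
  have hnn : inner ℝ n n = (1 : ℝ) := by rw [real_inner_self_eq_norm_sq, hn, one_pow]
  have hPs : ∀ (x : Space d) (s : ℝ), P (x + s • n) = P x := by
    intro x s
    rw [map_add, map_smul, hPn, smul_zero, add_zero]
  have hns : ∀ (x : Space d) (s : ℝ), inner ℝ n (x + s • n) = inner ℝ n x + s := by
    intro x s
    rw [inner_add_right, inner_smul_right, hnn, mul_one]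
  -- The boundary point is a limit of points strictly above the graph. Moving it by a positive
  -- amount along `n` therefore puts it strictly above, inside `D`.
  have hpγ : γ (P p) ≤ inner ℝ n p := by
    have hcl : p ∈ closure (D.carrier ∩ Metric.ball p r) :=
      Metric.isOpen_ball.closure_inter ⟨frontier_subset_closure hp, Metric.mem_ball_self hr⟩
    have hclosed : IsClosed {x : Space d | γ (P x) ≤ inner ℝ n x} :=
      isClosed_le (hγ.continuous.comp P.continuous) (continuous_const.inner continuous_id)
    exact closure_minimal (fun x hx => ((hD x hx.2).1 hx.1).le) hclosed hcl
  set a : Space d := (r / 2) • n with ha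
  have hna : ‖a‖ = r / 2 := by
    rw [ha, norm_smul, hn, mul_one, Real.norm_of_nonneg (by positivity)]
  have hq : p + a ∈ D.carrier := by
    rw [hD (p + a) (by rw [mem_ball_iff_norm, add_sub_cancel_left, hna]; linarith), ha, hPs, hns]
    linarith
  obtain ⟨ε, hε, hball⟩ := Metric.isOpen_iff.1 D.isOpen (p + a) hq
  -- Radius `ε` makes the shifted patch land in the interior ball around `p + a`; radius `r / 2`
  -- keeps the segments, of length at most `r / 2`, inside the ball where the graph describes `D`.
  refine ⟨min ε (r / 2), by positivity, ?_⟩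
  have hεB := isPoincareOn_ball hε hball
  refine IsPoincareOn.of_translate (Metric.isOpen_ball.inter D.isOpen) hεB (a := a) ?_ ?_
  · rintro x ⟨hx, hxD⟩ τ hτ
    have hx' : ‖x - p‖ < r / 2 := (mem_ball_iff_norm.1 hx).trans_le (min_le_right _ _)
    have h1 : ‖τ • a‖ ≤ r / 2 := by
      rw [norm_smul, hna, Real.norm_of_nonneg hτ.1]
      nlinarith [hτ.2]
    have h2 : x + τ • a ∈ Metric.ball p r := by
      rw [mem_ball_iff_norm, add_sub_right_comm]
      exact (norm_add_le _ _).trans_lt (by linarith)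
    have h3 := (hD x (Metric.ball_subset_ball (by linarith) (mem_ball_iff_norm.2 hx'))).1 hxD
    rw [hD _ h2, ha, smul_smul, hPs, hns]
    have : 0 ≤ τ * (r / 2) := mul_nonneg hτ.1 (by positivity)
    linarith
  · rintro x ⟨hx, -⟩
    rw [mem_ball_iff_norm, add_sub_add_right_eq_sub]
    exact (mem_ball_iff_norm.1 hx).trans_le (min_le_left _ _)

theorem exists_isPoincareOn_of_mem_closure {p : Space d} (hp : p ∈ closure D.carrier) :
    ∃ r > 0, IsPoincareOn D (Metric.ball p r ∩ D.carrier) := by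
  by_cases h : p ∈ D.carrier
  · obtain ⟨ε, hε, hball⟩ := Metric.isOpen_iff.1 D.isOpen p h
    refine ⟨ε, hε, ?_⟩
    rw [inter_eq_left.2 hball]
    exact isPoincareOn_ball hε hball
  · refine exists_isPoincareOn_of_mem_frontier ⟨hp, ?_⟩
    rwa [D.isOpen.interior_eq]

/-- Compactness of the closure gives a finite cover by good patches. A largest subfamily whose union
satisfies the inequality must cover `D`: otherwise connectedness makes its union meet one of the
remaining patches, and that patch could be added. -/
theorem isPoincareOn_carrier (D : LipschitzDomain d) : IsPoincareOn D D.carrier := by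
  classical
  have hcomp : IsCompact (closure D.carrier) := D.isBounded.isCompact_closure
  choose! r hr hP using fun p (hp : p ∈ closure D.carrier) =>
    exists_isPoincareOn_of_mem_closure hp
  obtain ⟨F, hF, hcov⟩ := hcomp.elim_nhds_subcover (fun p => Metric.ball p (r p))
    fun p hp => Metric.ball_mem_nhds p (hr p hp)
  let U : Space d → Set (Space d) := fun p => Metric.ball p (r p) ∩ D.carrier
  have hUo : ∀ p, IsOpen (U p) := fun p => Metric.isOpen_ball.inter D.isOpen
  have hUD : ∀ p, U p ⊆ D.carrier := fun p => inter_subset_right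
  let 𝒮 := F.powerset.filter fun S => S.Nonempty ∧ IsPoincareOn D (⋃ p ∈ S, U p)
  have h𝒮 : 𝒮.Nonempty := by
    obtain ⟨x, hx⟩ := D.isConnected.nonempty
    obtain ⟨p, hp, -⟩ := mem_iUnion₂.1 (hcov (subset_closure hx))
    refine ⟨{p}, Finset.mem_filter.2 ⟨Finset.mem_powerset.2 (Finset.singleton_subset_iff.2 hp),
      Finset.singleton_nonempty p, ?_⟩⟩
    simpa using hP p (hF p hp)
  obtain ⟨S, hS, hmax⟩ := Finset.exists_max_image 𝒮 Finset.card h𝒮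
  obtain ⟨hSF, ⟨p₀, hp₀⟩, hSP⟩ := Finset.mem_filter.1 hS
  rw [Finset.mem_powerset] at hSF
  have hAo : IsOpen (⋃ p ∈ S, U p) := isOpen_biUnion fun p _ => hUo p
  have hAD : (⋃ p ∈ S, U p) ⊆ D.carrier := iUnion₂_subset fun p _ => hUD p
  suffices hsub : D.carrier ⊆ ⋃ p ∈ S, U p by
    rwa [hAD.antisymm hsub] at hSP
  by_contra hne
  obtain ⟨x, hxD, hxA⟩ := not_subset.1 hne
  have hcovD : ∀ y ∈ D.carrier, ∃ p ∈ F, y ∈ U p := fun y hy => by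
    obtain ⟨p, hp, hyp⟩ := mem_iUnion₂.1 (hcov (subset_closure hy))
    exact ⟨p, hp, hyp, hy⟩
  have hUne : (D.carrier ∩ U p₀).Nonempty := by
    obtain ⟨y, hyD, hy⟩ := Metric.mem_closure_iff.1 (hF p₀ (hSF hp₀)) (r p₀)
      (hr p₀ (hF p₀ (hSF hp₀)))
    exact ⟨y, hyD, by rwa [Metric.mem_ball, dist_comm], hyD⟩
  obtain ⟨y, hyD, hyA, hyB⟩ := D.isConnected.isPreconnected (⋃ p ∈ S, U p)
    (⋃ p ∈ F \ S, U p) hAo (isOpen_biUnion fun p _ => hUo p) (by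
      intro y hy
      obtain ⟨p, hp, hyp⟩ := hcovD y hy
      by_cases hpS : p ∈ S
      · exact Or.inl (mem_biUnion hpS hyp)
      · exact Or.inr (mem_biUnion (Finset.mem_sdiff.2 ⟨hp, hpS⟩) hyp))
    (hUne.mono fun y hy => ⟨hy.1, mem_biUnion hp₀ hy.2⟩) (by
      obtain ⟨p, hp, hxp⟩ := hcovD x hxD
      exact ⟨x, hxD, mem_biUnion (Finset.mem_sdiff.2
        ⟨hp, fun hpS => hxA (mem_biUnion hpS hxp)⟩) hxp⟩)
  obtain ⟨q, hq, hyq⟩ := mem_iUnion₂.1 hyB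
  obtain ⟨hqF, hqS⟩ := Finset.mem_sdiff.1 hq
  have hins : insert q S ∈ 𝒮 := by
    refine Finset.mem_filter.2 ⟨Finset.mem_powerset.2 (Finset.insert_subset hqF hSF),
      Finset.insert_nonempty q S, ?_⟩
    rw [Finset.set_biUnion_insert]
    refine (hP q (hF q hqF)).union hSP (hUD q) hAD ?_
    -- A nonempty open overlap has positive measure, as gluing requires.
    exact (((hUo q).inter hAo).measure_pos volume ⟨y, hyq, hyA⟩).ne'
  have := hmax _ hins
  rw [Finset.card_insert_of_notMem hqS] at this
  omega

/-- The Poincaré inequality on a connected Lipschitz domain. -/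
theorem exists_norm_toL2_le (D : LipschitzDomain d) :
    ∃ C : ℝ, 0 ≤ C ∧ ∀ u ∈ H1MeanZero D, ‖toL2 D u‖ ≤ C * ‖grad D u‖ := by
  obtain ⟨C, hC⟩ := isPoincareOn_carrier D
  refine ⟨√C, Real.sqrt_nonneg _, fun u hu => ?_⟩
  obtain ⟨c, hc⟩ := hC u
  have hu0 : inner ℝ (toL2 D (one D)) (toL2 D u) = (0 : ℝ) := hu
  have e : ∫⁻ x in D.carrier, ‖extend D u x - c‖ₑ ^ 2 =
      ‖toL2 D u - c • toL2 D (one D)‖ₑ ^ 2 := by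
    rw [Lp.enorm_def]
    have e1 := eLpNorm_nnreal_pow_eq_lintegral (μ := D.vol) (p := 2)
      (f := (toL2 D u - c • toL2 D (one D) : L2 D)) two_ne_zero
    have e2 : eLpNorm (toL2 D u - c • toL2 D (one D) : L2 D) 2 D.vol ^ 2 =
      ∫⁻ x in D.carrier, ‖(toL2 D u - c • toL2 D (one D) : L2 D) x‖ₑ ^ 2 := by simpa using e1
    rw [e2]
    refine lintegral_congr_ae ?_
    filter_upwards [Lp.coeFn_sub (toL2 D u) (c • toL2 D (one D)),
      Lp.coeFn_smul c (toL2 D (one D)), Lp.coeFn_const (p := 2) (μ := D.vol) (1 : ℝ),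
      ae_restrict_mem D.isOpen.measurableSet] with x h1 h2 h3 hx
    have h4 : toL2 D (one D) x = 1 := h3
    rw [h1, Pi.sub_apply, h2, Pi.smul_apply, h4, extend, indicator_of_mem hx]
    simp
  rw [e] at hc
  have hc' : ‖toL2 D u - c • toL2 D (one D)‖ ^ 2 ≤ C * ‖grad D u‖ ^ 2 := by
    simp only [enorm_eq_nnnorm] at hc
    have : ‖toL2 D u - c • toL2 D (one D)‖₊ ^ 2 ≤ C * ‖grad D u‖₊ ^ 2 := by exact_mod_cast hc
    exact_mod_cast this
  -- A mean zero `u` is orthogonal to constants, so `‖u‖² ≤ ‖u - c‖²` for every `c`; it does not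
  -- matter which constant the gluing produced.
  rw [norm_sub_sq_real, inner_smul_right, real_inner_comm, hu0] at hc'
  have h5 : ‖toL2 D u‖ ^ 2 ≤ C * ‖grad D u‖ ^ 2 := by
    nlinarith [sq_nonneg ‖c • toL2 D (one D)‖]
  rw [← Real.sqrt_sq (norm_nonneg (toL2 D u)), ← Real.sqrt_sq (norm_nonneg (grad D u)),
    ← Real.sqrt_mul C.coe_nonneg]
  exact Real.sqrt_le_sqrt h5

end Poincare

/-! ### The Green operator -/

section Green

variable {D : LipschitzDomain d}

/-- For each test function and coordinate, the weak gradient identity equates two continuous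
functionals on `L² × L²`. The resulting completeness of `H¹(D)` is what Lax–Milgram needs. -/
theorem isClosed_H1Submodule (D : LipschitzDomain d) :
    IsClosed (H1Submodule D : Set (WithLp 2 (L2 D × L2Vec D))) := by
  have e : (H1Submodule D : Set (WithLp 2 (L2 D × L2Vec D))) =
      ⋂ (φ : Space d → ℝ) (hφ : IsTest D φ) (i : Fin d),
        {w | inner ℝ (hφ.memLp_deriv i).toLp w.fst = -inner ℝ ((hφ.memLp.continuousLinearMap_comp
          ((ContinuousLinearMap.id ℝ ℝ).smulRight (EuclideanSpace.single i (1 : ℝ)))).toLp)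
          w.snd} := by
    ext w
    simp only [mem_iInter]
    refine forall_congr' fun φ => forall_congr' fun hφ => forall_congr' fun i => ?_
    have hm : MemLp (fun x => ((ContinuousLinearMap.id ℝ ℝ).smulRight
        (EuclideanSpace.single i (1 : ℝ))) (φ x)) 2 D.vol := hφ.memLp.continuousLinearMap_comp _
    have e1 : inner ℝ (hφ.memLp_deriv i).toLp w.fst =
        ∫ x in D.carrier, w.fst x * fderiv ℝ φ x (EuclideanSpace.single i 1) := by
      rw [L2.inner_def]
      refine integral_congr_ae ?_
      filter_upwards [(hφ.memLp_deriv i).coeFn_toLp] with x hx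
      rw [hx]
      simp
    have e2 : inner ℝ hm.toLp w.snd = ∫ x in D.carrier, w.snd x i * φ x := by
      rw [L2.inner_def]
      refine integral_congr_ae ?_
      filter_upwards [hm.coeFn_toLp] with x hx
      rw [hx]
      simp [inner_smul_left, EuclideanSpace.inner_single_left, mul_comm]
    change _ = _ ↔ inner ℝ _ w.fst = -inner ℝ hm.toLp w.snd
    rw [e1, e2]
  rw [e]
  refine isClosed_iInter fun φ => isClosed_iInter fun hφ => isClosed_iInter fun i => ?_
  exact isClosed_eq ((innerSL ℝ _).continuous.comp (WithLp.fstL 2 ℝ (L2 D) (L2Vec D)).continuous)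
    ((innerSL ℝ _).continuous.comp (WithLp.sndL 2 ℝ (L2 D) (L2Vec D)).continuous).neg

instance (D : LipschitzDomain d) : CompleteSpace (H1 D) :=
  (isClosed_H1Submodule D).completeSpace_coe

instance (D : LipschitzDomain d) : CompleteSpace (H1MeanZero D) :=
  (integralL D).isClosed_ker.completeSpace_coe

theorem norm_sq_eq (u : H1 D) : ‖u‖ ^ 2 = ‖toL2 D u‖ ^ 2 + ‖grad D u‖ ^ 2 :=
  WithLp.prod_norm_sq_eq_of_L2 (u.1 : WithLp 2 (L2 D × L2Vec D))

theorem norm_grad_le (u : H1 D) : ‖grad D u‖ ≤ ‖u‖ := by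
  refine le_of_sq_le_sq ?_ (norm_nonneg u)
  rw [norm_sq_eq]
  nlinarith [sq_nonneg ‖toL2 D u‖]

theorem toL2_one_ae (D : LipschitzDomain d) : toL2 D (one D) =ᵐ[D.vol] fun _ => 1 :=
  Lp.coeFn_const (p := 2) (μ := D.vol) (1 : ℝ)

theorem integralL_one_ne_zero (D : LipschitzDomain d) : integralL D (one D) ≠ 0 := by
  have e : integralL D (one D) = ‖toL2 D (one D)‖ ^ 2 :=
    real_inner_self_eq_norm_sq (toL2 D (one D))
  rw [e]
  refine pow_ne_zero 2 (norm_ne_zero_iff.2 fun h => ?_)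
  rw [Lp.eq_zero_iff_ae_eq_zero] at h
  have hne : ∀ᵐ x ∂D.vol, False := by
    filter_upwards [h, toL2_one_ae D] with x h1 h2
    rw [h2] at h1
    exact one_ne_zero h1
  rw [ae_iff] at hne
  have h0 : volume D.carrier = 0 := by simpa using hne
  exact (D.isOpen.measure_pos volume D.isConnected.nonempty).ne' h0

/-- The Dirichlet form on the mean zero functions. -/
def dirichlet (D : LipschitzDomain d) : H1MeanZero D →L[ℝ] H1MeanZero D →L[ℝ] ℝ :=
  pairing ((grad D).comp (H1MeanZero D).subtypeL) ((grad D).comp (H1MeanZero D).subtypeL)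

theorem dirichlet_apply (u v : H1MeanZero D) :
    dirichlet D u v = inner ℝ (grad D (u : H1 D)) (grad D (v : H1 D)) := rfl

/-- The Poincaré inequality bounds the full `H¹` norm by the gradient norm on mean zero functions.
-/
theorem isCoercive_dirichlet (D : LipschitzDomain d) : IsCoercive (dirichlet D) := by
  obtain ⟨C, hC0, hC⟩ := exists_norm_toL2_le D
  refine ⟨(C ^ 2 + 1)⁻¹, by positivity, fun u => ?_⟩
  have h1 := hC u u.2
  have h2 : ‖u‖ ^ 2 = ‖toL2 D (u : H1 D)‖ ^ 2 + ‖grad D (u : H1 D)‖ ^ 2 := norm_sq_eq (u : H1 D)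
  rw [dirichlet_apply, real_inner_self_eq_norm_sq, mul_assoc, ← sq, h2,
    inv_mul_le_iff₀ (by positivity)]
  have h3 : ‖toL2 D (u : H1 D)‖ ^ 2 ≤ (C * ‖grad D (u : H1 D)‖) ^ 2 :=
    pow_le_pow_left₀ (norm_nonneg _) h1 2
  nlinarith

/-- A functional in `H` is determined by its values on mean zero functions. -/
theorem eq_of_forall_meanZero {ξ η : H1Dual D} (hξ : ξ ∈ H D) (hη : η ∈ H D)
    (h : ∀ J : H1MeanZero D, ξ (J : H1 D) = η (J : H1 D)) : ξ = η := by
  ext J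
  have hm := integralL_one_ne_zero D
  set c := integralL D J / integralL D (one D) with hc
  have hJ : J - c • one D ∈ H1MeanZero D := by
    change integralL D (J - c • one D) = 0
    rw [map_sub, map_smul, smul_eq_mul, hc, div_mul_cancel₀ _ hm, sub_self]
  have h1 := h ⟨_, hJ⟩
  have hξ' : ξ (one D) = 0 := hξ
  have hη' : η (one D) = 0 := hη
  simpa [hξ', hη'] using h1

/-- The solution operator of the Neumann problem. -/
def neumannSolution (D : LipschitzDomain d) : H D →L[ℝ] H1MeanZero D where
  toFun ξ := (isCoercive_dirichlet D).continuousLinearEquivOfBilin.symm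
    ((InnerProductSpace.toDual ℝ (H1MeanZero D)).symm
      ((ξ : H1Dual D).comp (H1MeanZero D).subtypeL))
  map_add' ξ η := by simp [ContinuousLinearMap.add_comp]
  map_smul' c ξ := by simp [ContinuousLinearMap.smul_comp]
  cont := (ContinuousLinearEquiv.continuous _).comp
    ((InnerProductSpace.toDual ℝ (H1MeanZero D)).symm.continuous.comp
      (((ContinuousLinearMap.compL ℝ (H1MeanZero D) (H1 D) ℝ).flip
        (H1MeanZero D).subtypeL).continuous.comp continuous_subtype_val))

theorem dirichlet_neumannSolution (ξ : H D) (J : H1MeanZero D) :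
    dirichlet D (neumannSolution D ξ) J = (ξ : H1Dual D) (J : H1 D) := by
  rw [← (isCoercive_dirichlet D).continuousLinearEquivOfBilin_apply]
  change inner ℝ ((isCoercive_dirichlet D).continuousLinearEquivOfBilin
    ((isCoercive_dirichlet D).continuousLinearEquivOfBilin.symm _)) J = _
  rw [ContinuousLinearEquiv.apply_symm_apply, InnerProductSpace.toDual_symm_apply]
  rfl

/-- Lax–Milgram gives the equation only for mean zero `J`; it extends to all of `H¹(D)` because both
functionals annihilate constants. -/
theorem negLaplacian_neumannSolution (ξ : H D) : negLaplacian D (neumannSolution D ξ) = ξ := by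
  refine Subtype.ext (eq_of_forall_meanZero (negLaplacian D _).2 ξ.2 fun J => ?_)
  exact dirichlet_neumannSolution ξ J

theorem neumannSolution_negLaplacian (w : H1MeanZero D) :
    neumannSolution D (negLaplacian D w) = w := by
  have h : ∀ J, dirichlet D (neumannSolution D (negLaplacian D w) - w) J = 0 := fun J => by
    rw [map_sub, sub_apply, dirichlet_neumannSolution]
    exact sub_self _
  obtain ⟨C, hC0, hC⟩ := isCoercive_dirichlet D
  have h1 := hC (neumannSolution D (negLaplacian D w) - w)
  rw [h, mul_assoc] at h1
  have h2 := nonpos_of_mul_nonpos_right h1 hC0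
  exact sub_eq_zero.1 (norm_eq_zero.1 (mul_self_eq_zero.1 (le_antisymm h2 (mul_self_nonneg _))))

/-- `ContinuousLinearMap.inverse` takes the value zero on maps that are not invertible. The
two-sided inverse constructed above excludes that case. -/
theorem green_eq_neumannSolution (D : LipschitzDomain d) : green D = neumannSolution D := by
  let e : H1MeanZero D ≃L[ℝ] H D := ContinuousLinearEquiv.equivOfInverse (negLaplacian D)
    (neumannSolution D) neumannSolution_negLaplacian negLaplacian_neumannSolution
  exact ContinuousLinearMap.inverse_equiv e

theorem inner_gradGreen_grad (ξ : H D) (J : H1 D) :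
    inner ℝ (gradGreen D ξ) (grad D J) = (ξ : H1Dual D) J := by
  have h := congrArg (fun η : H D => (η : H1Dual D) J) (negLaplacian_neumannSolution ξ)
  rw [← green_eq_neumannSolution] at h
  exact h

/-- Since `⟨ξ, J⟩ = (∇Gξ, ∇J)` and `‖∇J‖ ≤ ‖J‖`, an estimate in the norm of `H` passes to `H¹(D)*`.
-/
theorem norm_le_norm_gradGreen (ξ : H D) : ‖(ξ : H1Dual D)‖ ≤ ‖gradGreen D ξ‖ := by
  refine ContinuousLinearMap.opNorm_le_bound _ (norm_nonneg _) fun J => ?_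
  rw [← inner_gradGreen_grad]
  exact (norm_inner_le_norm _ _).trans
    (mul_le_mul_of_nonneg_left (norm_grad_le J) (norm_nonneg _))

end Green

/-! ### The energy inequality -/

section Energy

variable {X E : Type*} [NormedAddCommGroup X] [NormedSpace ℝ X] [NormedAddCommGroup E]
  [InnerProductSpace ℝ E]

/-- Translation is continuous in `L²`, tested against a fixed `L²` function. -/
theorem continuous_integral_translate_apply {W : ℝ → StrongDual ℝ X} {z : ℝ → X}
    (hW : MemLp W 2 volume) (hz : MemLp z 2 volume) :
    Continuous fun s : ℝ => ∫ t, W (t - s) (z t) := by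
  let B : StrongDual ℝ X →L[ℝ] X →L[ℝ] ℝ := ContinuousLinearMap.id ℝ _
  have hc : Continuous fun s : ℝ => B.lpPairing volume 2 2
      (DomAddAct.mk (-s) +ᵥ hW.toLp W) (hz.toLp z) := by
    have : Fact ((2 : ENNReal) ≠ ⊤) := ⟨by norm_num⟩
    have h1 : Continuous fun s : ℝ => DomAddAct.mk (-s) +ᵥ hW.toLp W :=
      Continuous.vadd (DomAddAct.mkHomeomorph.continuous.comp continuous_neg) continuous_const
    exact ((B.lpPairing volume 2 2).continuous.comp h1).clm_apply continuous_const
  convert hc using 2 with s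
  rw [ContinuousLinearMap.lpPairing_eq_integral]
  refine integral_congr_ae ?_
  have h2 := DomAddAct.mk_vadd_toLp (-s) hW
  rw [h2]
  filter_upwards [MemLp.coeFn_toLp (hW.comp_measurePreserving (measurePreserving_vadd (-s) volume)),
    MemLp.coeFn_toLp hz] with t h3 h4
  rw [h4]
  refine Eq.trans ?_ (congrArg (fun L => B L (z t)) h3.symm)
  simp [B, sub_eq_neg_add]

/-- Justifies Fubini in the energy argument: the integrand is dominated by `‖W(t - s)‖² + ‖z(t)‖²`,
integrable because `s` ranges over a finite measure. -/
theorem integrable_translate_apply {W : ℝ → StrongDual ℝ X} {z : ℝ → X}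
    (hW : MemLp W 2 volume) (hz : MemLp z 2 volume) (ν : Measure ℝ) [IsFiniteMeasure ν]
    (hν : ν ≪ volume) :
    Integrable (fun p : ℝ × ℝ => W (p.1 - p.2) (z p.1)) (volume.prod ν) := by
  have h1 : Integrable (fun p : ℝ × ℝ => (1 : ℝ) * ‖W (p.1 - p.2)‖ ^ 2) (volume.prod ν) :=
    Integrable.convolution_integrand (f := fun _ => (1 : ℝ)) (g := fun t => ‖W t‖ ^ 2)
      (ContinuousLinearMap.mul ℝ ℝ) (integrable_const 1) (hW.integrable_norm_pow two_ne_zero)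
  have h2 : Integrable (fun p : ℝ × ℝ => ‖z p.1‖ ^ 2 * 1) (volume.prod ν) :=
    (hz.integrable_norm_pow two_ne_zero).mul_prod (integrable_const (1 : ℝ))
  have hq : Measure.QuasiMeasurePreserving (fun p : ℝ × ℝ => p.1 - p.2) (volume.prod ν) volume :=
    (quasiMeasurePreserving_sub volume volume).mono_left
      (Measure.AbsolutelyContinuous.prod Measure.AbsolutelyContinuous.rfl hν)
  have hm : AEStronglyMeasurable (fun p : ℝ × ℝ => W (p.1 - p.2) (z p.1)) (volume.prod ν) :=
    (ContinuousLinearMap.id ℝ (StrongDual ℝ X)).aestronglyMeasurable_comp₂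
      (hW.aestronglyMeasurable.comp_quasiMeasurePreserving hq) hz.aestronglyMeasurable.comp_fst
  refine (h1.add h2).mono' hm (Eventually.of_forall fun p => ?_)
  simp only [Pi.add_apply]
  refine ((W (p.1 - p.2)).le_opNorm (z p.1)).trans ?_
  nlinarith [sq_nonneg (‖W (p.1 - p.2)‖ - ‖z p.1‖), norm_nonneg (W (p.1 - p.2)),
    norm_nonneg (z p.1)]

/-- No smoothing in time is needed. From `‖a‖² - ‖b‖² ≤ 2 ⟪a - b, a⟫` with `a = w(t)` and `b = w(t -
ε)`, integration over `[0, b]` telescopes on the left to an integral over `[b - ε, b]`. On the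
right, `w(t) - w(t - ε)` tested with `z(t)` is the integral of `W(t - s)(z(t))` over `s ∈ [0, ε]`.
Dividing by `ε` and letting `ε → 0` uses continuity of `w` and of translations in `L²`. -/
theorem norm_sq_le_two_mul_integral_of_continuous {w : ℝ → E} {ι : X →L[ℝ] E}
    {W : ℝ → StrongDual ℝ X} {z : ℝ → X} {b : ℝ} (hb : 0 ≤ b)
    (hw : Continuous w) (hw0 : ∀ t ≤ 0, w t = 0) (hW : MemLp W 2 volume) (hz : MemLp z 2 volume)
    (hz0 : ∀ t, t ∉ Ioc 0 b → z t = 0) (hzw : ∀ᵐ t, t ∈ Ioc 0 b → ι (z t) = w t)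
    (hwW : ∀ t ≤ b, ∀ g, inner ℝ (w t) (ι g) = (∫ s in (0 : ℝ)..t, W s) g) :
    ‖w b‖ ^ 2 ≤ 2 * ∫ t, W t (z t) := by
  set F : ℝ → ℝ := fun s => ∫ t, W (t - s) (z t) with hF
  have hFc : Continuous F := continuous_integral_translate_apply hW hz
  have hφ : Continuous fun t => ‖w t‖ ^ 2 := hw.norm.pow 2
  have hWi : ∀ a c : ℝ, IntervalIntegrable W volume a c := fun a c =>
    (hW.locallyIntegrable (by norm_num)).integrableOn_isCompact isCompact_uIcc |>.intervalIntegrable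
  have key : ∀ ε : ℝ, 0 ≤ ε → ∫ t in (b - ε)..b, ‖w t‖ ^ 2 ≤ 2 * ∫ s in (0 : ℝ)..ε, F s := by
    intro ε hε
    have hii : ∀ a c : ℝ, IntervalIntegrable (fun t => ‖w t‖ ^ 2) volume a c :=
      fun a c => hφ.intervalIntegrable a c
    have e1 : ∫ t in (b - ε)..b, ‖w t‖ ^ 2 =
        ∫ t in (0 : ℝ)..b, (‖w t‖ ^ 2 - ‖w (t - ε)‖ ^ 2) := by
      have hφ' : Continuous fun t => ‖w (t - ε)‖ ^ 2 := hφ.comp (continuous_sub_right ε)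
      rw [intervalIntegral.integral_sub (hii _ _) (hφ'.intervalIntegrable _ _),
        intervalIntegral.integral_comp_sub_right (fun t => ‖w t‖ ^ 2)]
      have e2 : ∫ t in (0 - ε)..0, ‖w t‖ ^ 2 = 0 := by
        rw [intervalIntegral.integral_congr (g := fun _ => (0 : ℝ))]
        · simp
        · intro t ht
          rw [uIcc_of_le (by linarith)] at ht
          simp [hw0 t ht.2]
      have e3 := intervalIntegral.integral_add_adjacent_intervals (hii (0 - ε) 0) (hii 0 (b - ε))
      have e4 := intervalIntegral.integral_add_adjacent_intervals (hii 0 (b - ε)) (hii (b - ε) b)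
      linarith
    have hG := integrable_translate_apply hW hz (volume.restrict (Ioc 0 ε))
      Measure.restrict_le_self.absolutelyContinuous
    have e5 : ∫ s in (0 : ℝ)..ε, F s = ∫ t, ∫ s in Ioc 0 ε, W (t - s) (z t) := by
      rw [intervalIntegral.integral_of_le hε]
      exact (integral_integral_swap hG).symm
    have e6 : ∫ t, ∫ s in Ioc 0 ε, W (t - s) (z t) =
        ∫ t in (0 : ℝ)..b, ∫ s in Ioc 0 ε, W (t - s) (z t) := by
      rw [intervalIntegral.integral_of_le hb, setIntegral_eq_integral_of_forall_compl_eq_zero]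
      intro t ht
      simp [hz0 t ht]
    rw [e1, e5, e6, ← intervalIntegral.integral_const_mul]
    refine intervalIntegral.integral_mono_ae_restrict hb
      ((hφ.sub (hφ.comp (continuous_sub_right ε))).intervalIntegrable _ _)
      (hG.integral_prod_left.const_mul 2).intervalIntegrable ?_
    rw [← Measure.restrict_congr_set Ioc_ae_eq_Icc]
    filter_upwards [ae_restrict_of_ae hzw, ae_restrict_mem measurableSet_Ioc] with t h1 ht
    have h2 := h1 ht
    -- Here `t - ε` may be negative, which is why the primitive formula is assumed for all times up
    -- to `b`.
    have e7 : ∫ s in Ioc 0 ε, W (t - s) (z t) = inner ℝ (w t - w (t - ε)) (w t) := by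
      rw [← intervalIntegral.integral_of_le hε,
        intervalIntegral.integral_comp_sub_left (fun s => W s (z t)),
        ← ContinuousLinearMap.intervalIntegral_apply (hWi _ _), sub_zero,
        ← intervalIntegral.integral_interval_sub_left (hWi 0 t) (hWi 0 (t - ε)), sub_apply,
        ← hwW t ht.2, ← hwW (t - ε) (by linarith [ht.2]), ← inner_sub_left, h2]
    rw [e7, inner_sub_left, real_inner_self_eq_norm_sq]
    have h3 : 0 ≤ ‖w t - w (t - ε)‖ ^ 2 := by positivity
    rw [norm_sub_sq_real, real_inner_comm] at h3
    linarith
  have hd : HasDerivAt (fun ε => 2 * (∫ s in (0 : ℝ)..ε, F s) - ∫ t in (b - ε)..b, ‖w t‖ ^ 2)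
      (2 * F 0 - ‖w b‖ ^ 2) 0 := by
    have h1 : HasDerivAt (fun ε => ∫ s in (0 : ℝ)..ε, F s) (F 0) 0 :=
      intervalIntegral.integral_hasDerivAt_right
        (hFc.intervalIntegrable _ _) (hFc.stronglyMeasurableAtFilter _ _) hFc.continuousAt
    have h2 : HasDerivAt (fun a => ∫ t in a..b, ‖w t‖ ^ 2) (-‖w b‖ ^ 2) b :=
      intervalIntegral.integral_hasDerivAt_left
        (hφ.intervalIntegrable _ _) (hφ.stronglyMeasurableAtFilter _ _) hφ.continuousAt
    have h3 : HasDerivAt (fun ε : ℝ => b - ε) (-1) 0 := (hasDerivAt_id (0 : ℝ)).const_sub b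
    have h4 := HasDerivAt.comp (h₂ := fun a => ∫ t in a..b, ‖w t‖ ^ 2) (0 : ℝ)
      (by simpa using h2) h3
    have e : 2 * F 0 - ‖w b‖ ^ 2 = 2 * F 0 - -‖w b‖ ^ 2 * -1 := by ring
    rw [e]
    exact (h1.const_mul 2).sub h4
  have hslope := (hasDerivWithinAt_iff_tendsto_slope' (s := Ioi (0 : ℝ)) (by simp)).1
    hd.hasDerivWithinAt
  -- The function of `ε` vanishes at `0` and is nonnegative for `ε > 0` by `key`, so its derivative
  -- at `0` is nonnegative.
  have h0 : 0 ≤ 2 * F 0 - ‖w b‖ ^ 2 := by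
    refine ge_of_tendsto hslope ?_
    filter_upwards [self_mem_nhdsWithin] with ε hε
    have hε' : 0 < ε := hε
    have := key ε hε'.le
    rw [slope_def_field]
    refine div_nonneg ?_ (by linarith)
    simp
    linarith
  have hF0 : F 0 = ∫ t, W t (z t) := by simp [hF]
  rw [← hF0]
  linarith

/-- The energy inequality for a continuous function `w` with values in a Hilbert space `E` which is,
at almost every time, in the image of `X`, and has a derivative in `L²(0, T; X*)`. -/
theorem norm_sq_le_two_mul_integral {w : ℝ → E} {ι : X →L[ℝ] E}
    {W : ℝ → StrongDual ℝ X} {z : ℝ → X} {T b : ℝ} (hb : b ∈ Icc 0 T)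
    (hw : ContinuousOn w (Icc 0 T)) (hw0 : w 0 = 0) (hW : MemL2Time T W) (hz : MemL2Time T z)
    (hzw : ∀ᵐ t ∂volume.restrict (Icc 0 T), ι (z t) = w t)
    (hwW : ∀ t ∈ Icc 0 T, ∀ g, inner ℝ (w t) (ι g) = (∫ s in (0 : ℝ)..t, W s) g) :
    ‖w b‖ ^ 2 ≤ 2 * ∫ t in (0 : ℝ)..b, W t (z t) := by
  have hT : 0 ≤ T := hb.1.trans hb.2
  have hsub : Ioc 0 b ⊆ Icc 0 T := fun t ht => ⟨ht.1.le, ht.2.trans hb.2⟩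
  have hW' : MemLp ((Icc 0 T).indicator W) 2 volume :=
    (memLp_indicator_iff_restrict measurableSet_Icc).2 hW
  have hz' : MemLp ((Ioc 0 b).indicator z) 2 volume :=
    (memLp_indicator_iff_restrict measurableSet_Ioc).2 (hz.mono_measure (Measure.restrict_mono_set _ hsub))
  -- Extension to the whole line: `w` by its endpoint values (`w 0 = 0` on the left), `W` and `z` by
  -- zero.
  have hw' : Continuous fun t => w (projIcc 0 T hT t) :=
    hw.domRestrict.comp continuous_projIcc
  have main := norm_sq_le_two_mul_integral_of_continuous (ι := ι) hb.1 hw' (fun t ht => by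
      rw [projIcc_of_le_left hT ht, hw0]) hW' hz' (fun t ht => indicator_of_notMem ht _) (by
      have := (ae_restrict_iff' measurableSet_Icc).1 hzw
      filter_upwards [this] with t h1 ht
      rw [indicator_of_mem ht, h1 (hsub ht), projIcc_of_mem hT (hsub ht)]) (by
      intro t ht g
      rcases le_total t 0 with h | h
      · rw [projIcc_of_le_left hT h]
        have e0 : ∫ s in (0 : ℝ)..t, (Icc 0 T).indicator W s = 0 := by
          rw [intervalIntegral.integral_symm, intervalIntegral.integral_of_le h,
            integral_Ioc_eq_integral_Ioo, neg_eq_zero]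
          refine setIntegral_eq_zero_of_forall_eq_zero fun s hs => indicator_of_notMem ?_ _
          exact fun h' => absurd h'.1 (not_le.2 hs.2)
        rw [e0, hw0]
        simp
      · have hmem : t ∈ Icc 0 T := ⟨h, ht.trans hb.2⟩
        rw [projIcc_of_mem hT hmem, hwW t hmem g]
        congr 1
        refine intervalIntegral.integral_congr fun s hs => ?_
        rw [uIcc_of_le h] at hs
        exact (indicator_of_mem (show s ∈ Icc 0 T from ⟨hs.1, hs.2.trans hmem.2⟩) W).symm)
  rw [projIcc_of_mem hT hb] at main
  refine main.trans_eq ?_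
  rw [intervalIntegral.integral_of_le hb.1, ← integral_indicator measurableSet_Ioc]
  congr 2
  ext t
  by_cases ht : t ∈ Ioc 0 b
  · rw [indicator_of_mem ht, indicator_of_mem ht, indicator_of_mem (hsub ht)]
  · rw [indicator_of_notMem ht, indicator_of_notMem ht, map_zero]

end Energy

/-! ### Convex functions with two-sided monotonicity bounds -/

section Convex

variable {σ : Space d → ℝ} {cm cp : ℝ}

theorem IsSurfaceTension.hasGradientAt (hσ : IsSurfaceTension σ cm cp) (x : Space d) :
    HasGradientAt σ (gradient σ x) x :=
  (hσ.contDiff.differentiable (by simp) x).hasGradientAt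

theorem IsSurfaceTension.exists_mean_value (hσ : IsSurfaceTension σ cm cp) (x y : Space d) :
    ∃ θ ∈ Ioo (0 : ℝ) 1,
      σ y - σ x = inner ℝ (gradient σ (x + θ • (y - x))) (y - x) := by
  have hder : ∀ t : ℝ, HasDerivAt (fun t : ℝ => σ (x + t • (y - x)))
      (inner ℝ (gradient σ (x + t • (y - x))) (y - x)) t := by
    intro t
    have h1 : HasDerivAt (fun t : ℝ => x + t • (y - x)) (y - x) t := by
      simpa using ((hasDerivAt_id t).smul_const (y - x)).const_add x
    have h2 := (hσ.hasGradientAt (x + t • (y - x))).hasFDerivAt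
    have h3 := h2.comp_hasDerivAt t h1
    simpa [Function.comp_def] using h3
  obtain ⟨θ, hθ, h⟩ := exists_hasDerivAt_eq_slope (fun t : ℝ => σ (x + t • (y - x))) _ zero_lt_one
    (fun t _ => (hder t).continuousAt.continuousWithinAt) (fun t _ => hder t)
  refine ⟨θ, hθ, ?_⟩
  simpa using h.symm

theorem IsSurfaceTension.linear_le (hσ : IsSurfaceTension σ cm cp) (hcm : 0 ≤ cm)
    (x y : Space d) : σ x + inner ℝ (gradient σ x) (y - x) ≤ σ y := by
  obtain ⟨θ, hθ, h⟩ := hσ.exists_mean_value x y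
  have h1 := hσ.lower (x + θ • (y - x)) x
  rw [add_sub_cancel_left, inner_smul_right, inner_sub_left] at h1
  have h2 : 0 ≤ θ * (inner ℝ (gradient σ (x + θ • (y - x))) (y - x) -
      inner ℝ (gradient σ x) (y - x)) := le_trans (by positivity) h1
  have h3 := nonneg_of_mul_nonneg_right h2 hθ.1
  linarith

/-- Using one intermediate point instead of integrating along the segment costs a factor: `cp`
stands in place of `cp / 2`. This is the source of the later Lipschitz constant `2 * cp`. -/
theorem IsSurfaceTension.le_quadratic (hσ : IsSurfaceTension σ cm cp) (hcp : 0 ≤ cp)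
    (x y : Space d) : σ y ≤ σ x + inner ℝ (gradient σ x) (y - x) + cp * ‖y - x‖ ^ 2 := by
  obtain ⟨θ, hθ, h⟩ := hσ.exists_mean_value x y
  have h1 := hσ.upper (x + θ • (y - x)) x
  rw [add_sub_cancel_left, inner_smul_right, inner_sub_left, norm_smul, mul_pow,
    Real.norm_eq_abs, sq_abs] at h1
  have h2 : θ * (inner ℝ (gradient σ (x + θ • (y - x))) (y - x) -
      inner ℝ (gradient σ x) (y - x)) ≤ θ * (θ * (cp * ‖y - x‖ ^ 2)) := by linarith
  have h3 := le_of_mul_le_mul_left h2 hθ.1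
  have h4 : θ * (cp * ‖y - x‖ ^ 2) ≤ 1 * (cp * ‖y - x‖ ^ 2) :=
    mul_le_mul_of_nonneg_right hθ.2.le (by positivity)
  linarith

/-- A convex function with the upper bound on its gradient increments has a Lipschitz gradient. -/
theorem IsSurfaceTension.norm_gradient_sub_le (hσ : IsSurfaceTension σ cm cp) (hcm : 0 ≤ cm)
    (hcp : 0 < cp) (x y : Space d) : ‖gradient σ y - gradient σ x‖ ≤ 2 * cp * ‖y - x‖ := by
  set m := gradient σ y - gradient σ x with hm
  -- This `z` minimises `⟪m, z - y⟫ + cp ‖z - y‖²`. Comparing the tangent at `x` with the quadratic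
  -- upper bound at `y`, both evaluated at `z`, yields the estimate.
  set z : Space d := y - (2 * cp)⁻¹ • m with hz
  have h1 := hσ.linear_le hcm x z
  have h2 := hσ.le_quadratic hcp.le y z
  have h3 := hσ.le_quadratic hcp.le x y
  have hzy : z - y = -((2 * cp)⁻¹ • m) := by rw [hz]; abel
  have e1 : inner ℝ (gradient σ x) (z - x) =
      inner ℝ (gradient σ x) (z - y) + inner ℝ (gradient σ x) (y - x) := by
    rw [← inner_add_right, sub_add_sub_cancel]
  have e2 : inner ℝ (gradient σ y) (z - y) - inner ℝ (gradient σ x) (z - y) =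
      -((2 * cp)⁻¹ * ‖m‖ ^ 2) := by
    rw [← inner_sub_left, ← hm, hzy, inner_neg_right, inner_smul_right,
      real_inner_self_eq_norm_sq]
  have e3 : cp * ‖z - y‖ ^ 2 = (4 * cp)⁻¹ * ‖m‖ ^ 2 := by
    rw [hzy, norm_neg, norm_smul, Real.norm_of_nonneg (by positivity)]
    field_simp
    ring
  have e4 : (2 * cp)⁻¹ * ‖m‖ ^ 2 = 2 * ((4 * cp)⁻¹ * ‖m‖ ^ 2) := by
    field_simp
    ring
  have h4 : (4 * cp)⁻¹ * ‖m‖ ^ 2 ≤ cp * ‖y - x‖ ^ 2 := by linarith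
  have h5 : ‖m‖ ^ 2 ≤ (2 * cp * ‖y - x‖) ^ 2 := by
    rw [inv_mul_le_iff₀ (by positivity)] at h4
    calc ‖m‖ ^ 2 ≤ 4 * cp * (cp * ‖y - x‖ ^ 2) := h4
      _ = _ := by ring
  exact le_of_sq_le_sq h5 (by positivity)

end Convex

/-! ### Mollification of the surface tension -/

section Mollify

theorem IsMollifier.hasCompactSupport {ρ : Space d → ℝ} (hρ : IsMollifier ρ) :
    HasCompactSupport ρ :=
  (isCompact_closedBall (0 : Space d) 1).of_isClosed_subset (isClosed_tsupport ρ)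
    (hρ.tsupport_subset.trans Metric.ball_subset_closedBall)

theorem continuous_rescale {ρ : Space d → ℝ} (hρ : IsMollifier ρ) (δ : ℝ) :
    Continuous (rescale ρ δ) :=
  continuous_const.mul (hρ.contDiff.continuous.comp (continuous_const_smul δ⁻¹))

theorem rescale_nonneg {ρ : Space d → ℝ} (hρ : IsMollifier ρ) {δ : ℝ} (hδ : 0 < δ) (u : Space d) :
    0 ≤ rescale ρ δ u :=
  mul_nonneg (by positivity) (hρ.nonneg _)

theorem norm_lt_of_rescale_ne_zero {ρ : Space d → ℝ} (hρ : IsMollifier ρ) {δ : ℝ} (hδ : 0 < δ)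
    {u : Space d} (hu : rescale ρ δ u ≠ 0) : ‖u‖ < δ := by
  have h1 : ρ (δ⁻¹ • u) ≠ 0 := right_ne_zero_of_mul hu
  have h2 := hρ.tsupport_subset (subset_tsupport ρ h1)
  rw [mem_ball_zero_iff, norm_smul, Real.norm_of_nonneg (by positivity),
    inv_mul_lt_iff₀ hδ, mul_one] at h2
  exact h2

theorem hasCompactSupport_rescale {ρ : Space d → ℝ} (hρ : IsMollifier ρ) {δ : ℝ} (hδ : 0 < δ) :
    HasCompactSupport (rescale ρ δ) :=
  HasCompactSupport.intro (isCompact_closedBall (0 : Space d) δ) fun x hx => by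
    by_contra h
    exact hx (mem_closedBall_zero_iff.2 (norm_lt_of_rescale_ne_zero hρ hδ h).le)

theorem integral_rescale {ρ : Space d → ℝ} (hρ : IsMollifier ρ) {δ : ℝ} (hδ : 0 < δ) :
    ∫ u, rescale ρ δ u = 1 := by
  unfold rescale
  rw [integral_const_mul, Measure.integral_comp_inv_smul, finrank_euclideanSpace_fin,
    hρ.integral_eq_one, abs_of_nonneg (by positivity), smul_eq_mul, mul_one]
  exact inv_mul_cancel₀ (by positivity)

variable {σ : Space d → ℝ} {cm cp : ℝ}

theorem IsSurfaceTension.continuous_gradient (hσ : IsSurfaceTension σ cm cp) :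
    Continuous (gradient σ) :=
  (InnerProductSpace.toDual ℝ (Space d)).symm.continuous.comp
    (hσ.contDiff.continuous_fderiv (by simp))

/-- The expansion of `σ` at `u - v` has remainder at most `cp ‖x - u‖²` uniformly in `v`. Averaging
against the probability density `rescale ρ δ` keeps this bound, so the candidate gradient is correct
to second order. -/
theorem IsSurfaceTension.hasGradientAt_mollify (hσ : IsSurfaceTension σ cm cp) (hcm : 0 ≤ cm)
    (hcp : 0 < cp) {ρ : Space d → ℝ} (hρ : IsMollifier ρ) {δ : ℝ} (hδ : 0 < δ) (u : Space d) :
    HasGradientAt (mollify σ ρ δ) (∫ v, rescale ρ δ v • gradient σ (u - v)) u := by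
  have hk := continuous_rescale hρ δ
  have hks := hasCompactSupport_rescale hρ hδ
  have hint : ∀ x : Space d, Integrable fun v => rescale ρ δ v * σ (x - v) := fun x =>
    (hk.mul (hσ.contDiff.continuous.comp (continuous_sub_left x))).integrable_of_hasCompactSupport
      hks.mul_right
  have hgint : Integrable fun v => rescale ρ δ v • gradient σ (u - v) :=
    (hk.smul (hσ.continuous_gradient.comp
      (continuous_sub_left u))).integrable_of_hasCompactSupport hks.smul_right
  have hmol : ∀ x, mollify σ ρ δ x = ∫ v, rescale ρ δ v * σ (x - v) := by
    intro x
    rw [mollify, convolution_eq_swap]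
    simp [mul_comm]
  set g := ∫ v, rescale ρ δ v • gradient σ (u - v) with hg
  have hbound : ∀ x, ‖mollify σ ρ δ x - mollify σ ρ δ u - inner ℝ g (x - u)‖ ≤
      cp * ‖x - u‖ ^ 2 := by
    intro x
    have hinner : inner ℝ g (x - u) =
        ∫ v, rescale ρ δ v * inner ℝ (gradient σ (u - v)) (x - u) := by
      rw [hg, real_inner_comm, ← integral_inner hgint]
      refine integral_congr_ae (Eventually.of_forall fun v => ?_)
      simp only
      rw [inner_smul_right, real_inner_comm]
    have hgint' : Integrable fun v => rescale ρ δ v * inner ℝ (gradient σ (u - v)) (x - u) := by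
      refine (hgint.inner_const (𝕜 := ℝ) (x - u)).congr (Eventually.of_forall fun v => ?_)
      simp only
      rw [real_inner_smul_left]
    have hsub : Integrable fun v => rescale ρ δ v * σ (x - v) - rescale ρ δ v * σ (u - v) :=
      (hint x).sub (hint u)
    rw [hmol, hmol, hinner, ← integral_sub (hint x) (hint u), ← integral_sub hsub hgint']
    have hb : ∀ v, ‖rescale ρ δ v * σ (x - v) - rescale ρ δ v * σ (u - v) -
        rescale ρ δ v * inner ℝ (gradient σ (u - v)) (x - u)‖ ≤
        rescale ρ δ v * (cp * ‖x - u‖ ^ 2) := by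
      intro v
      have h1 := hσ.linear_le hcm (u - v) (x - v)
      have h2 := hσ.le_quadratic hcp.le (u - v) (x - v)
      rw [sub_sub_sub_cancel_right] at h1 h2
      rw [← mul_sub, ← mul_sub, norm_mul, Real.norm_of_nonneg (rescale_nonneg hρ hδ v)]
      refine mul_le_mul_of_nonneg_left ?_ (rescale_nonneg hρ hδ v)
      rw [Real.norm_eq_abs, abs_le]
      have h3 : 0 ≤ cp * ‖x - u‖ ^ 2 := by positivity
      constructor <;> linarith
    refine (norm_integral_le_of_norm_le
      ((hk.integrable_of_hasCompactSupport hks).mul_const _) (Eventually.of_forall hb)).trans ?_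
    rw [integral_mul_const, integral_rescale hρ hδ, one_mul]
  have h0 : HasFDerivAt (fun x => mollify σ ρ δ x - mollify σ ρ δ u - inner ℝ g (x - u))
      (0 : Space d →L[ℝ] ℝ) u := by
    refine Asymptotics.IsBigO.hasFDerivAt (n := 2) (Asymptotics.IsBigO.of_bound cp
      (Eventually.of_forall fun x => ?_)) one_lt_two
    rw [norm_pow, norm_norm]
    exact hbound x
  have h1 : HasFDerivAt (fun x => inner ℝ g (x - u))
      (InnerProductSpace.toDual ℝ (Space d) g) u :=
    HasFDerivAt.comp (g := InnerProductSpace.toDual ℝ (Space d) g) (f := fun x => x - u) u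
      (InnerProductSpace.toDual ℝ (Space d) g).hasFDerivAt ((hasFDerivAt_id u).sub_const u)
  have h2 := (h0.add h1).add_const (mollify σ ρ δ u)
  rw [zero_add] at h2
  refine hasGradientAt_iff_hasFDerivAt.2 (h2.congr_of_eventuallyEq (Eventually.of_forall ?_))
  intro x
  simp

/-- The mollified gradient averages `∇σ` over displacements shorter than `δ`, and `∇σ` is Lipschitz;
the bound is uniform in `u`. -/
theorem IsSurfaceTension.norm_gradient_mollify_sub_le (hσ : IsSurfaceTension σ cm cp)
    (hcm : 0 ≤ cm) (hcp : 0 < cp) {ρ : Space d → ℝ} (hρ : IsMollifier ρ) {δ : ℝ} (hδ : 0 < δ)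
    (u : Space d) : ‖gradient (mollify σ ρ δ) u - gradient σ u‖ ≤ 2 * cp * δ := by
  have hk := continuous_rescale hρ δ
  have hks := hasCompactSupport_rescale hρ hδ
  have hgint : Integrable fun v => rescale ρ δ v • gradient σ (u - v) :=
    (hk.smul (hσ.continuous_gradient.comp
      (continuous_sub_left u))).integrable_of_hasCompactSupport hks.smul_right
  have hki := hk.integrable_of_hasCompactSupport (μ := (volume : Measure (Space d))) hks
  have e : gradient σ u = ∫ v, rescale ρ δ v • gradient σ u := by
    rw [integral_smul_const, integral_rescale hρ hδ, one_smul]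
  rw [(hσ.hasGradientAt_mollify hcm hcp hρ hδ u).gradient]
  rw [e, ← integral_sub hgint (hki.smul_const _)]
  have hb : ∀ v, ‖rescale ρ δ v • gradient σ (u - v) - rescale ρ δ v • gradient σ u‖ ≤
      rescale ρ δ v * (2 * cp * δ) := by
    intro v
    rw [← smul_sub, norm_smul, Real.norm_of_nonneg (rescale_nonneg hρ hδ v)]
    by_cases hv : rescale ρ δ v = 0
    · simp [hv]
    refine mul_le_mul_of_nonneg_left ?_ (rescale_nonneg hρ hδ v)
    refine (hσ.norm_gradient_sub_le hcm hcp u (u - v)).trans ?_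
    refine mul_le_mul_of_nonneg_left ?_ (by positivity)
    rw [sub_sub_cancel_left, norm_neg]
    exact (norm_lt_of_rescale_ne_zero hρ hδ hv).le
  refine (norm_integral_le_of_norm_le (hki.mul_const _) (Eventually.of_forall hb)).trans ?_
  rw [integral_mul_const, integral_rescale hρ hδ, one_mul]

end Mollify

/-! ### Stability of the evolution with respect to the surface tension -/

section Stability

variable {D : LipschitzDomain d}

theorem measurable_gradient (σ : Space d → ℝ) : Measurable (gradient σ) :=
  (InnerProductSpace.toDual ℝ (Space d)).symm.continuous.measurable.comp (measurable_fderiv ℝ σ)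

/-- Linear growth and boundedness of `D` ensure that `flux` is the true composition and not its
default value `0`. -/
theorem memLp_gradient_comp {σ : Space d → ℝ} {A B : ℝ}
    (h : ∀ y, ‖gradient σ y‖ ≤ A + B * ‖y‖) (p : L2Vec D) :
    MemLp (fun x => gradient σ (p x)) 2 D.vol := by
  have hg : MemLp (fun x => A + B * ‖p x‖) 2 D.vol :=
    (memLp_const A).add ((Lp.memLp p).norm.const_mul B)
  refine hg.mono' ?_ (Eventually.of_forall fun x => h (p x))
  exact ((measurable_gradient σ).comp
    (Lp.stronglyMeasurable p).measurable).aestronglyMeasurable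

theorem coeFn_flux {σ : Space d → ℝ} {p : L2Vec D}
    (hp : MemLp (fun x => gradient σ (p x)) 2 D.vol) :
    flux D σ p =ᵐ[D.vol] fun x => gradient σ (p x) := by
  rw [flux, dif_pos hp]
  exact hp.coeFn_toLp

variable {σ : Space d → ℝ} {cm cp : ℝ}

theorem IsSurfaceTension.norm_gradient_le (hσ : IsSurfaceTension σ cm cp) (hcm : 0 ≤ cm)
    (hcp : 0 < cp) (y : Space d) : ‖gradient σ y‖ ≤ ‖gradient σ 0‖ + 2 * cp * ‖y‖ := by
  have h := hσ.norm_gradient_sub_le hcm hcp 0 y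
  rw [sub_zero] at h
  have h2 := norm_sub_norm_le (gradient σ y) (gradient σ 0)
  linarith

theorem IsSurfaceTension.norm_gradient_mollify_le (hσ : IsSurfaceTension σ cm cp) (hcm : 0 ≤ cm)
    (hcp : 0 < cp) {ρ : Space d → ℝ} (hρ : IsMollifier ρ) {δ : ℝ} (hδ : 0 < δ) (y : Space d) :
    ‖gradient (mollify σ ρ δ) y‖ ≤ ‖gradient σ 0‖ + 2 * cp * δ + 2 * cp * ‖y‖ := by
  have h1 := hσ.norm_gradient_le hcm hcp y
  have h2 := hσ.norm_gradient_mollify_sub_le hcm hcp hρ hδ y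
  have h3 := norm_sub_norm_le (gradient (mollify σ ρ δ) y) (gradient σ y)
  linarith

/-- The monotonicity of the flux survives mollification up to an error of order `δ²`. -/
theorem IsSurfaceTension.neg_le_inner_flux_sub (hσ : IsSurfaceTension σ cm cp) (hcm : 0 < cm)
    (hcp : 0 < cp) {ρ : Space d → ℝ} (hρ : IsMollifier ρ) {δ : ℝ} (hδ : 0 < δ) (p q : L2Vec D) :
    -(cp ^ 2 / cm * D.vol.real univ * δ ^ 2) ≤
      inner ℝ (flux D σ p - flux D (mollify σ ρ δ) q) (p - q) := by
  have hp := coeFn_flux (memLp_gradient_comp (hσ.norm_gradient_le hcm.le hcp) p)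
  have hq := coeFn_flux (memLp_gradient_comp (hσ.norm_gradient_mollify_le hcm.le hcp hρ hδ) q)
  have e : -(cp ^ 2 / cm * D.vol.real univ * δ ^ 2) =
      ∫ _, -(cp ^ 2 / cm * δ ^ 2) ∂D.vol := by
    rw [integral_const, smul_eq_mul]
    ring
  rw [e, L2.inner_def]
  refine integral_mono_ae (integrable_const _) (L2.integrable_inner _ _) ?_
  filter_upwards [hp, hq, Lp.coeFn_sub p q,
    Lp.coeFn_sub (flux D σ p) (flux D (mollify σ ρ δ) q)] with x h1 h2 h3 h4
  rw [h3, h4, Pi.sub_apply, Pi.sub_apply, h1, h2]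
  have h5 := hσ.lower (p x) (q x)
  have h6 : inner ℝ (gradient (mollify σ ρ δ) (q x) - gradient σ (q x)) (p x - q x) ≤
      2 * cp * δ * ‖p x - q x‖ :=
    (real_inner_le_norm _ _).trans (mul_le_mul_of_nonneg_right
      (hσ.norm_gradient_mollify_sub_le hcm.le hcp hρ hδ (q x)) (norm_nonneg _))
  have h7 : inner ℝ (gradient σ (p x) - gradient (mollify σ ρ δ) (q x)) (p x - q x) =
      inner ℝ (gradient σ (p x) - gradient σ (q x)) (p x - q x) -
        inner ℝ (gradient (mollify σ ρ δ) (q x) - gradient σ (q x)) (p x - q x) := by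
    rw [← inner_sub_left, sub_sub_sub_cancel_right]
  -- Completing the square: the quadratic in `‖p x - q x‖` is smallest at `cp * δ / cm`.
  have h8 : -(cp ^ 2 / cm * δ ^ 2) ≤
      cm * ‖p x - q x‖ ^ 2 - 2 * cp * δ * ‖p x - q x‖ := by
    have h9 : cm * ‖p x - q x‖ ^ 2 - 2 * cp * δ * ‖p x - q x‖ + cp ^ 2 / cm * δ ^ 2 =
        (cm * ‖p x - q x‖ - cp * δ) ^ 2 / cm := by
      field_simp
      ring
    have h10 : 0 ≤ (cm * ‖p x - q x‖ - cp * δ) ^ 2 / cm := by positivity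
    linarith
  rw [h7]
  linarith

theorem MemL2Time.intervalIntegrable {X : Type*} [NormedAddCommGroup X] {T : ℝ} {U : ℝ → X}
    (hU : MemL2Time T U) {t : ℝ} (ht : t ∈ Icc 0 T) : IntervalIntegrable U volume 0 t := by
  rw [intervalIntegrable_iff_integrableOn_Icc_of_le ht.1]
  exact IntegrableOn.mono_set (hU.integrable (by norm_num)) (Icc_subset_Icc_right ht.2)

/-- The almost everywhere derivative of a primitive is its density. -/
theorem ae_eq_of_hasDerivAt_of_eq_integral {X : Type*} [NormedAddCommGroup X] [NormedSpace ℝ X]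
    [CompleteSpace X] {F U A : ℝ → X} {T : ℝ} (hT : 0 ≤ T) (hU : MemL2Time T U)
    (hF : ∀ t ∈ Icc 0 T, F t = F 0 + ∫ s in (0 : ℝ)..t, U s)
    (hA : ∀ᵐ t ∂volume.restrict (Icc 0 T), HasDerivAt F (A t) t) :
    U =ᵐ[volume.restrict (Icc 0 T)] A := by
  have hUi : IntervalIntegrable U volume 0 T := hU.intervalIntegrable ⟨hT, le_rfl⟩
  -- The formula for `F` holds only on `[0, T]`, so two-sided derivatives are compared at interior
  -- times.
  rw [← Measure.restrict_congr_set Ioo_ae_eq_Icc] at hA ⊢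
  filter_upwards [hA, ae_restrict_of_ae hUi.ae_hasDerivAt_integral,
    ae_restrict_mem measurableSet_Ioo] with t h1 h2 ht
  have h3 := h2 (by rw [uIcc_of_le hT]; exact Ioo_subset_Icc_self ht) 0 left_mem_uIcc
  have h4 : F =ᶠ[𝓝 t] fun s => F 0 + ∫ r in (0 : ℝ)..s, U r := by
    filter_upwards [Ioo_mem_nhds ht.1 ht.2] with s hs
    exact hF s (Ioo_subset_Icc_self hs)
  exact ((h3.const_add (F 0)).congr_of_eventuallyEq h4).unique h1

/-- Two evolutions with the same initial datum stay close if the difference of their fluxes is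
almost monotone. -/
theorem IsSolutionWith.norm_sub_sq_le {σ σ' : Space d → ℝ} {T M : ℝ} {h₀ : H1Dual D}
    {h h' : ℝ → H1Dual D} {f f' : H1 D} {u u' : ℝ → H D} {v v' : ℝ → V D} (hM : 0 ≤ M)
    (hs : IsSolutionWith D σ T h₀ h f u v) (hs' : IsSolutionWith D σ' T h₀ h' f' u' v')
    (hflux : ∀ p q : L2Vec D, -M ≤ inner ℝ (flux D σ p - flux D σ' q) (p - q))
    {t : ℝ} (ht : t ∈ Icc 0 T) : ‖h t - h' t‖ ^ 2 ≤ 2 * T * M := by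
  have hT : 0 ≤ T := ht.1.trans ht.2
  have hmean : f - f' ∈ H1MeanZero D := by
    have h1 : inner ℝ (toL2 D f) (toL2 D (one D)) = inner ℝ (toL2 D f') (toL2 D (one D)) :=
      hs.mean_eq.symm.trans hs'.mean_eq
    change inner ℝ (toL2 D (one D)) (toL2 D (f - f')) = (0 : ℝ)
    rw [map_sub, inner_sub_right, real_inner_comm, h1, real_inner_comm, sub_self]
  -- The two solutions may use different auxiliary functions; the correction `e` makes `w = h - h'`
  -- exactly.
  let e : V D := ⟨f - f', Submodule.sub_mem _ hs.mem_H10 hs'.mem_H10, hmean⟩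
  let w : ℝ → H D := fun t => u t - u' t + vToH D e
  let z : ℝ → V D := fun t => v t - v' t + e
  have hcoe : ∀ t ∈ Icc 0 T, (w t : H1Dual D) = h t - h' t := by
    intro t ht
    have h1 : (vToH D e : H1Dual D) = toDual D f - toDual D f' := map_sub (toDual D) f f'
    have h2 : (w t : H1Dual D) = (u t : H1Dual D) - u' t + vToH D e := rfl
    rw [h2, hs.coe_u t ht, hs'.coe_u t ht, h1]
    abel
  have hw0 : w 0 = 0 := by
    have h0 : (0 : ℝ) ∈ Icc 0 T := ⟨le_rfl, hT⟩
    have h1 : h 0 = h₀ := sub_left_injective ((hs.coe_u 0 h0).symm.trans hs.initial)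
    have h2 : h' 0 = h₀ := sub_left_injective ((hs'.coe_u 0 h0).symm.trans hs'.initial)
    refine Subtype.ext ?_
    rw [hcoe 0 h0, h1, h2, sub_self]
    rfl
  obtain ⟨U, hU, hUi⟩ := hs.memW12
  obtain ⟨U', hU', hUi'⟩ := hs'.memW12
  have hW : ∀ t ∈ Icc 0 T, hToVDual D (w t) = ∫ s in (0 : ℝ)..t, (U s - U' s) := by
    intro t ht
    have h1 : ∀ t, hToVDual D (w t) =
        hToVDual D (u t) - hToVDual D (u' t) + hToVDual D (vToH D e) := fun t => by
      rw [map_add, map_sub]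
    have h2 := h1 0
    rw [hw0, map_zero] at h2
    rw [intervalIntegral.integral_sub (hU.intervalIntegrable ht) (hU'.intervalIntegrable ht), h1, ← sub_zero (_ - _ + _),
      h2, ← sub_eq_iff_eq_add'.2 (hUi t ht), ← sub_eq_iff_eq_add'.2 (hUi' t ht)]
    abel
  have hz : MemL2Time T z := (hs.memL2.sub hs'.memL2).add (memLp_const e)
  have hzw : ∀ᵐ t ∂volume.restrict (Icc 0 T),
      ((gradGreen D).comp (vToH D)) (z t) = gradGreen D (w t) := by
    filter_upwards [hs.coe_v, hs'.coe_v] with t h1 h2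
    change gradGreen D (vToH D (v t - v' t + e)) = gradGreen D (u t - u' t + vToH D e)
    rw [map_add (vToH D), map_sub (vToH D), h1, h2]
  have hwc : ContinuousOn (fun t => gradGreen D (w t)) (Icc 0 T) :=
    (gradGreen D).continuous.comp_continuousOn
      ((hs.continuousOn.sub hs'.continuousOn).add continuousOn_const)
  -- The map `gradGreen` carries the inner product of `H` to that of `L²(D; ℝ^d)`, so the energy
  -- inequality is applied there.
  have energy := norm_sq_le_two_mul_integral (ι := (gradGreen D).comp (vToH D)) ht hwc
    (by rw [hw0, map_zero]) (hU.sub hU') hz hzw fun s hs g => congrArg (fun L => L g) (hW s hs)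
  have hdiss : ∀ᵐ s ∂volume.restrict (Icc 0 T), (U s - U' s) (z s) ≤ M := by
    filter_upwards [ae_eq_of_hasDerivAt_of_eq_integral hT hU hUi hs.equation,
      ae_eq_of_hasDerivAt_of_eq_integral hT hU' hUi' hs'.equation] with s h1 h2
    have h3 : grad D (z s : H1 D) =
        (grad D (v s : H1 D) + grad D f) - (grad D (v' s : H1 D) + grad D f') := by
      have h4 : (z s : H1 D) = (v s : H1 D) - (v' s : H1 D) + (f - f') := rfl
      rw [h4, map_add, map_sub, map_sub]
      abel
    have h5 := hflux (grad D (v s : H1 D) + grad D f) (grad D (v' s : H1 D) + grad D f')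
    rw [← h3, inner_sub_left] at h5
    rw [h1, h2, sub_apply, opA_apply, opA_apply]
    linarith
  have hbound : ∫ s in (0 : ℝ)..t, (U s - U' s) (z s) ≤ t * M := by
    have h1 : Icc 0 t ⊆ Icc 0 T := Icc_subset_Icc_right ht.2
    have h2 : ∫ _ in (0 : ℝ)..t, M = t * M := by simp
    -- If the integrand were not integrable, its integral would be `0` by convention, and the bound
    -- would still hold since `M ≥ 0`.
    by_cases hi : IntervalIntegrable (fun s => (U s - U' s) (z s)) volume 0 t
    · rw [← h2]
      exact intervalIntegral.integral_mono_ae_restrict ht.1 hi intervalIntegrable_const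
        (ae_restrict_of_ae_restrict_of_subset h1 hdiss)
    · rw [intervalIntegral.integral_undef hi]
      exact mul_nonneg ht.1 hM
  have h1 : ‖h t - h' t‖ ≤ ‖gradGreen D (w t)‖ := by
    rw [← hcoe t ht]
    exact norm_le_norm_gradGreen (w t)
  have h2 : ‖h t - h' t‖ ^ 2 ≤ ‖gradGreen D (w t)‖ ^ 2 := pow_le_pow_left₀ (norm_nonneg _) h1 2
  have h3 : t * M ≤ T * M := mul_le_mul_of_nonneg_right ht.2 hM
  have h4 : ‖gradGreen D (w t)‖ ^ 2 ≤ 2 * ∫ s in (0 : ℝ)..t, (U s - U' s) (z s) := energy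
  linarith

end Stability

end InterfacePDE

end
theorem proposition3p1 {d : ℕ} (hd : 1 ≤ d) (D : InterfacePDE.LipschitzDomain d)
    (σ : InterfacePDE.Space d → ℝ) (cm cp : ℝ) (hcm : 0 < cm) (hcp : 0 < cp)
    (hσ : InterfacePDE.IsSurfaceTension σ cm cp)
    (ρ : InterfacePDE.Space d → ℝ) (hρ : InterfacePDE.IsMollifier ρ)
    (T : ℝ) (hT : 0 < T) (h₀ : InterfacePDE.H1Dual D)
    (h : ℝ → InterfacePDE.H1Dual D) (hδ : ℝ → ℝ → InterfacePDE.H1Dual D)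
    (hsol : InterfacePDE.IsSolution D σ T h₀ h)
    (hsolδ : ∀ δ ∈ Set.Ioc (0 : ℝ) 1,
      InterfacePDE.IsSolution D (InterfacePDE.mollify σ ρ δ) T h₀ (hδ δ)) :
    ∀ t ∈ Set.Icc 0 T, Filter.Tendsto (fun δ => ‖h t - hδ δ t‖) (nhdsWithin 0 (Set.Ioi 0)) (nhds 0) := by

  intro t ht
  obtain ⟨f, u, v, hs⟩ := hsol
  set K : ℝ := cp ^ 2 / cm * D.vol.real Set.univ with hK
  have hK0 : 0 ≤ K := by positivity
  -- The stability estimate with `M = K δ²` has a square root linear in `δ`.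
  have hle : ∀ δ ∈ Set.Ioc (0 : ℝ) 1, ‖h t - hδ δ t‖ ≤ √(2 * T * K) * δ := by
    intro δ hmem
    obtain ⟨f', u', v', hs'⟩ := hsolδ δ hmem
    have h1 := hs.norm_sub_sq_le (M := K * δ ^ 2) (by positivity) hs'
      (fun p q => hσ.neg_le_inner_flux_sub hcm hcp hρ hmem.1 p q) ht
    have h2 : 2 * T * (K * δ ^ 2) = (√(2 * T * K) * δ) ^ 2 := by
      rw [mul_pow, Real.sq_sqrt (by positivity)]
      ring
    rw [h2] at h1
    exact le_of_sq_le_sq h1 (mul_nonneg (Real.sqrt_nonneg _) hmem.1.le)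
  have hlim : Filter.Tendsto (fun δ : ℝ => √(2 * T * K) * δ) (nhdsWithin 0 (Set.Ioi 0))
      (nhds 0) := by
    have hc : Continuous fun δ : ℝ => √(2 * T * K) * δ := continuous_const.mul continuous_id
    simpa using (hc.tendsto 0).mono_left nhdsWithin_le_nhds
  refine squeeze_zero' (Filter.Eventually.of_forall fun δ => norm_nonneg _) ?_ hlim
  filter_upwards [Ioc_mem_nhdsGT (zero_lt_one' ℝ)] with δ hmem
  exact hle δ hmem
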